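/- Let $\mathfrak g$ be a finite-dimensional real Lie algebra with $[\mathfrak g,[\mathfrak g,\mathfrak g]]=0$, and let $G=(\mathfrak g,\cdot)$ be its simply connected group, with $x\cdot y=x+y+\tfrac12[x,y]$. Let $G$ act on $\mathfrak g^*$ by the coadjoint action, $O_\ell=\mathrm{Ad}^*(G)\ell$, and give $\mathfrak g^*/G$ the quotient topology. For $\ell\in\mathfrak g^*$ put $\mathfrak g(\ell)=\{X:\langle\ell,[X,\mathfrak g]\rangle=0\}$; for a subspace $\mathfrak w\subset\mathfrak g$ let $\mathfrak w^\perp\subset\mathfrak g^*$ be its annihilator. For a sequence $(t_k)_k$ in a topological space let $L((t_k)_k)$ be the set of all its limits; the sequence is called properly converging if $L((t_k)_k)\neq\emptyset$ and every subsequence has the same limit set. A set of orbits is also regarded as the subset of $\mathfrak g^*$ that it covers. Let $(O_k)_k$ be a properly converging sequence in $\mathfrak g^*/G$, and let $\ell\in\mathfrak g^*$ with $O_\ell\in L((O_k)_k)$. Then there are $\ell_k\in O_k$ with $\ell_k\to\ell$, a number $d$ with $\dim O_k=d$ for all large $k$, and a subalgebra $\mathfrak u$ with $[\mathfrak g,\mathfrak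 g]\subset\mathfrak u\subset\mathfrak g(\ell)$ such that $\mathfrak g(\ell_k)\to\mathfrak u$ in the Grassmannian; moreover $L((O_k)_k)=\ell+\mathfrak u^\perp$ as a subset of $\mathfrak g^*$, and at least one of the following holds. 1. $\mathfrak u=\mathfrak g(\ell)$, and $L((O_k)_k)$ is the single orbit $O_\ell=\ell+\mathfrak g(\ell)^\perp$. 2. $\langle\ell,[\mathfrak g,\mathfrak g]\rangle=\{0\}$, and $L((O_k)_k)$ is the affine subspace $\ell+\mathfrak u^\perp$, all of whose elements are characters of $\mathfrak g$ (they vanish on $[\mathfrak g,\mathfrak g]$). 3. $0<\dim O_\ell<d$, and $L((O_k)_k)=\bigcup_{q\in\mathfrak u^\perp}(q+O_\ell)$. Moreover, let $\widehat G$ be the unitary dual of $G$ with the Fell topology. If $\pi_k\in\widehat G$ has the Kirillov orbit $O_k$ for every $k$ (that is, $\pi_k=[\mathrm{ind}_{P_k}^G\chi_{m_k}]$ for some $m_k\in O_k$ and some polarization $\mathfrak p_k$ in $m_k$, $P_k=\exp\mathfrak p_k$), then for every polarization $\mathfrak p$ in $\ell$, with $P=\exp\mathfrak p$, $$L((\pi_k)_k)=\big\{[\chi_q\otimes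 \mathrm{ind}_P^G\chi_\ell] : q\in\mathfrak u^\perp\big\}.$$ Here $\chi_\ell(x)=e^{-2\pi i\langle\ell,x\rangle}$, and a polarization in $\ell$ is a subalgebra $\mathfrak p$ with $\langle\ell,[\mathfrak p,\mathfrak p]\rangle=\{0\}$ and $\dim\mathfrak p=\frac12(\dim\mathfrak g+\dim\mathfrak g(\ell))$. -/

import Mathlib

open Filter Topology MeasureTheory
open scoped ENNReal

set_option linter.unusedSectionVars false
set_option linter.unusedSimpArgs false

noncomputable section

namespace TwoStep

universe u

/-! ### Two-step nilpotent Lie algebras and their simply connected groups -/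

/-- The derived algebra is contained in the centre. -/
class IsTwoStep (𝔤 : Type*) [LieRing 𝔤] : Prop where
  lie_lie_eq_zero : ∀ x y z : 𝔤, ⁅x, ⁅y, z⁆⁆ = 0

/-- The simply connected connected Lie group of `𝔤`: the space `𝔤` itself with the
Campbell-Baker-Hausdorff multiplication. The exponential map is the identity. -/
def Grp (𝔤 : Type*) : Type _ := 𝔤

namespace Grp

/-- The exponential map. -/
def exp {𝔤 : Type*} (x : 𝔤) : Grp 𝔤 := x

/-- The inverse of the exponential map. -/
def log {𝔤 : Type*} (x : Grp 𝔤) : 𝔤 := x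

instance {𝔤 : Type*} [t : TopologicalSpace 𝔤] : TopologicalSpace (Grp 𝔤) := t

section

variable {𝔤 : Type*} [LieRing 𝔤] [LieAlgebra ℝ 𝔤]

instance : Mul (Grp 𝔤) := ⟨fun x y => exp (log x + log y + (1 / 2 : ℝ) • ⁅log x, log y⁆)⟩
instance : One (Grp 𝔤) := ⟨exp 0⟩
instance : Inv (Grp 𝔤) := ⟨fun x => exp (-log x)⟩

@[simp] theorem log_exp (x : 𝔤) : log (exp x) = x := rfl
@[simp] theorem exp_log (x : Grp 𝔤) : exp (log x) = x := rfl
theorem log_mul (x y : Grp 𝔤) :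
    log (x * y) = log x + log y + (1 / 2 : ℝ) • ⁅log x, log y⁆ := rfl
@[simp] theorem log_one : log (1 : Grp 𝔤) = 0 := rfl
@[simp] theorem log_inv (x : Grp 𝔤) : log x⁻¹ = -log x := rfl
theorem log_injective : Function.Injective (log : Grp 𝔤 → 𝔤) := fun _ _ h => h

theorem lie_lie_left [IsTwoStep 𝔤] (x y z : 𝔤) : ⁅⁅x, y⁆, z⁆ = 0 := by
  rw [← lie_skew, IsTwoStep.lie_lie_eq_zero, neg_zero]

instance [IsTwoStep 𝔤] : Group (Grp 𝔤) where
  mul_assoc x y z := log_injective <| by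
    simp only [log_mul, lie_add, add_lie, lie_smul, smul_lie, lie_lie_left,
      IsTwoStep.lie_lie_eq_zero, smul_zero, smul_add, add_zero]
    abel
  one_mul x := log_injective <| by simp [log_mul]
  mul_one x := log_injective <| by simp [log_mul]
  inv_mul_cancel x := log_injective <| by simp [log_mul]

/-- The adjoint action, `Ad x Y = x · Y · x⁻¹`; the exponential map is the identity. -/
def Ad [IsTwoStep 𝔤] (x : Grp 𝔤) : 𝔤 →ₗ[ℝ] 𝔤 where
  toFun y := log (x * exp y * x⁻¹)
  map_add' y z := by
    simp only [log_mul, log_exp, log_inv, lie_add, add_lie, lie_smul, smul_lie, lie_lie_left,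
      lie_neg, neg_lie, lie_self, smul_add, smul_zero, smul_neg, neg_zero, add_zero]
    abel
  map_smul' c y := by
    simp only [log_mul, log_exp, log_inv, lie_smul, add_lie, smul_lie, lie_lie_left,
      lie_neg, neg_lie, lie_self, smul_add, smul_zero, smul_neg, neg_zero, add_zero, zero_add,
      RingHom.id_apply, smul_comm c]
    abel

theorem Ad_apply [IsTwoStep 𝔤] (x : Grp 𝔤) (y : 𝔤) : Ad x y = log (x * exp y * x⁻¹) := rfl

end

end Grp

open Grp

section Orbits

variable {𝔤 : Type*} [LieRing 𝔤] [LieAlgebra ℝ 𝔤]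

/-- The dual `𝔤*` of a finite dimensional space with its canonical topology, the topology of
pointwise convergence. -/
instance dualTopology : TopologicalSpace (Module.Dual ℝ 𝔤) :=
  TopologicalSpace.induced (fun (ℓ : Module.Dual ℝ 𝔤) (x : 𝔤) => ℓ x) inferInstance

/-- The coadjoint action `Ad*(x) ℓ = ℓ ∘ Ad(x⁻¹)`. -/
instance coadjointAction [IsTwoStep 𝔤] : MulAction (Grp 𝔤) (Module.Dual ℝ 𝔤) where
  smul x ℓ := ℓ.comp (Ad x⁻¹)
  one_smul ℓ := LinearMap.ext fun y => by
    change ℓ (Ad (1 : Grp 𝔤)⁻¹ y) = ℓ y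
    simp [Ad_apply]
  mul_smul x x' ℓ := LinearMap.ext fun y => by
    change ℓ (Ad (x * x')⁻¹ y) = ℓ (Ad x'⁻¹ (Ad x⁻¹ y))
    simp only [Ad_apply, exp_log, mul_inv_rev, inv_inv, mul_assoc]

variable (𝔤) in
/-- The space `𝔤*/G` of coadjoint orbits, with the quotient topology. -/
abbrev OrbitSpace [IsTwoStep 𝔤] : Type _ :=
  MulAction.orbitRel.Quotient (Grp 𝔤) (Module.Dual ℝ 𝔤)

/-- The coadjoint orbit `O_ℓ`, as a point of the orbit space. -/
def orbitOf [IsTwoStep 𝔤] (ℓ : Module.Dual ℝ 𝔤) : OrbitSpace 𝔤 := Quotient.mk'' ℓ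

/-- The dimension of a coadjoint orbit `O ⊆ 𝔤*` (which is an affine subspace of `𝔤*`). -/
def orbitDim [IsTwoStep 𝔤] (O : OrbitSpace 𝔤) : ℕ := Module.finrank ℝ (vectorSpan ℝ O.orbit)

/-- The subset of `𝔤*` covered by a set of coadjoint orbits. -/
def orbitUnion [IsTwoStep 𝔤] (A : Set (OrbitSpace 𝔤)) : Set (Module.Dual ℝ 𝔤) :=
  ⋃ O ∈ A, O.orbit

/-- The skew bilinear form `B_ℓ(X, Y) = ℓ [X, Y]`. -/
def bracketForm (ℓ : Module.Dual ℝ 𝔤) : LinearMap.BilinForm ℝ 𝔤 :=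
  LinearMap.mk₂ ℝ (fun x y => ℓ ⁅x, y⁆) (by simp) (by simp) (by simp) (by simp)

/-- The radical `𝔤(ℓ)` of `B_ℓ`. -/
def radical (ℓ : Module.Dual ℝ 𝔤) : Submodule ℝ 𝔤 where
  carrier := {x | ∀ y, ℓ ⁅x, y⁆ = 0}
  add_mem' hx hy z := by simp [hx z, hy z]
  zero_mem' z := by simp
  smul_mem' c x hx z := by simp [hx z]

/-- `ℓ` is a character of the Lie algebra: it vanishes on `[𝔤, 𝔤]`. -/
def IsChar (ℓ : Module.Dual ℝ 𝔤) : Prop := ∀ x y : 𝔤, ℓ ⁅x, y⁆ = 0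

end Orbits

/-! ### Convergence -/

/-- The set of all limits of a sequence. -/
def limitSet {T : Type*} [TopologicalSpace T] (t : ℕ → T) : Set T :=
  {x | Tendsto t atTop (𝓝 x)}

/-- The sequence has a limit, and every subsequence has the same limit set. -/
def ProperlyConverging {T : Type*} [TopologicalSpace T] (t : ℕ → T) : Prop :=
  (limitSet t).Nonempty ∧ ∀ φ : ℕ → ℕ, StrictMono φ → limitSet (t ∘ φ) = limitSet t

/-- Convergence of subspaces in the Grassmannian: suitable bases of `W k` (for large `k`) converge
to a basis of `W₀`. -/
def SubspaceTendsto {V : Type*} [AddCommGroup V] [Module ℝ V] [TopologicalSpace V]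
    (W : ℕ → Submodule ℝ V) (W₀ : Submodule ℝ V) : Prop :=
  ∃ (m : ℕ) (b : ℕ → Fin m → V) (b₀ : Fin m → V),
    (LinearIndependent ℝ b₀ ∧ Submodule.span ℝ (Set.range b₀) = W₀) ∧
    (∀ᶠ k in atTop, LinearIndependent ℝ (b k) ∧ Submodule.span ℝ (Set.range (b k)) = W k) ∧
    ∀ i, Tendsto (fun k => b k i) atTop (𝓝 (b₀ i))

/-! ### Unitary representations and the unitary dual -/

/-- A strongly continuous unitary representation of `G` on a complex Hilbert space. -/
structure UnitaryRep (G : Type u) [Group G] [TopologicalSpace G] : Type (max u 1) where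
  H : Type
  [normed : NormedAddCommGroup H]
  [inner : InnerProductSpace ℂ H]
  [complete : CompleteSpace H]
  ρ : G →* (H ≃ₗᵢ[ℂ] H)
  continuous_apply : ∀ ξ : H, Continuous fun x => ρ x ξ

attribute [instance] UnitaryRep.normed UnitaryRep.inner UnitaryRep.complete

section Dual

variable {G : Type u} [Group G] [TopologicalSpace G]

namespace UnitaryRep

/-- Unitary equivalence. -/
def Equivalent (π π' : UnitaryRep G) : Prop :=
  ∃ U : π.H ≃ₗᵢ[ℂ] π'.H, ∀ x ξ, U (π.ρ x ξ) = π'.ρ x (U ξ)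

instance setoid : Setoid (UnitaryRep G) where
  r := Equivalent
  iseqv :=
    { refl := fun π => ⟨LinearIsometryEquiv.refl ℂ π.H, fun _ _ => rfl⟩
      symm := fun {π π'} ⟨U, hU⟩ => ⟨U.symm, fun x ξ => by
        rw [LinearIsometryEquiv.symm_apply_eq, hU, LinearIsometryEquiv.apply_symm_apply]⟩
      trans := fun ⟨U, hU⟩ ⟨V, hV⟩ => ⟨U.trans V, fun x ξ => by simp [hU, hV]⟩ }

/-- The Hilbert space is non-zero and has no closed invariant subspaces but the trivial ones. -/
def IsIrreducible (π : UnitaryRep G) : Prop :=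
  Nontrivial π.H ∧ ∀ K : Submodule ℂ π.H, IsClosed (K : Set π.H) →
    (∀ x, ∀ ξ ∈ K, π.ρ x ξ ∈ K) → K = ⊥ ∨ K = ⊤

/-- The tensor product `χ ⊗ π` of a representation with a continuous unitary character. -/
def twist (χ : G →* Circle) (hχ : Continuous χ) (π : UnitaryRep G) : UnitaryRep G where
  H := π.H
  ρ :=
    { toFun := fun x =>
        { toFun := fun ξ => (χ x : ℂ) • π.ρ x ξ
          invFun := fun ξ => (χ x⁻¹ : ℂ) • π.ρ x⁻¹ ξ
          map_add' := by simp
          map_smul' := fun c ξ => by simp [smul_comm c]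
          left_inv := fun ξ => by
            simp [smul_smul]
          right_inv := fun ξ => by
            simp [smul_smul]
          norm_map' := fun ξ => by
            change ‖(χ x : ℂ) • π.ρ x ξ‖ = ‖ξ‖
            rw [norm_smul, Circle.norm_coe, one_mul, LinearIsometryEquiv.norm_map] }
      map_one' := by ext ξ; simp
      map_mul' := fun x y => by ext ξ; simp [smul_smul] }
  continuous_apply ξ := by
    exact (continuous_subtype_val.comp hχ).smul (π.continuous_apply ξ)

end UnitaryRep

variable (G) in
/-- Unitary equivalence classes of unitary representations. -/
abbrev RepClass : Type _ := Quotient (UnitaryRep.setoid (G := G))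

variable (G) in
/-- The unitary dual `Ĝ`: the equivalence classes of irreducible unitary representations. -/
def UnitaryDual : Type _ := {c : RepClass G // ∃ π : UnitaryRep G, π.IsIrreducible ∧ ⟦π⟧ = c}

/-- The classes in `Ĝ` that have a sum of functions of positive type which is `ε`-close on the set
`Q` to the function `x ↦ ⟨π(x) ξ, ξ⟩`. -/
def fellNhd (π : UnitaryRep G) (ξ : π.H) (Q : Set G) (ε : ℝ) : Set (UnitaryDual G) :=
  {γ | ∃ τ : UnitaryRep G, ⟦τ⟧ = γ.1 ∧ ∃ (n : ℕ) (η : Fin n → τ.H), ∀ x ∈ Q,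
    ‖inner ℂ ξ (π.ρ x ξ) - ∑ j, inner ℂ (η j) (τ.ρ x (η j))‖ < ε}

/-- The Fell topology of `Ĝ`. -/
instance fellTopology : TopologicalSpace (UnitaryDual G) :=
  TopologicalSpace.generateFrom
    {W | ∃ (π : UnitaryRep G) (ξ : π.H) (Q : Set G) (ε : ℝ),
      π.IsIrreducible ∧ IsCompact Q ∧ 0 < ε ∧ W = fellNhd π ξ Q ε}

end Dual

/-! ### Polarizations and induced representations -/

section Induced

variable {𝔤 : Type u} [LieRing 𝔤] [LieAlgebra ℝ 𝔤]

/-- A polarization in `ℓ`: a subalgebra subordinated to `ℓ` of dimension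
`(dim 𝔤 + dim 𝔤(ℓ)) / 2`. -/
def IsPolarization (ℓ : Module.Dual ℝ 𝔤) (p : LieSubalgebra ℝ 𝔤) : Prop :=
  (∀ x ∈ p, ∀ y ∈ p, ℓ ⁅x, y⁆ = 0) ∧
    2 * Module.finrank ℝ p = Module.finrank ℝ 𝔤 + Module.finrank ℝ (radical ℓ)

/-- Linear coordinates `σ : ℝᵐ ≃ 𝔰` on a complement `𝔰 = range σ` of `p` in `𝔤`;
`σ ∘ τ` is the projection of `𝔤 = 𝔰 ⊕ p` onto `𝔰`. -/
structure Coords (p : LieSubalgebra ℝ 𝔤) where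
  m : ℕ
  σ : (Fin m → ℝ) →ₗ[ℝ] 𝔤
  τ : 𝔤 →ₗ[ℝ] (Fin m → ℝ)
  τ_σ : ∀ r, τ (σ r) = r
  ker_τ : LinearMap.ker τ = p.toSubmodule

theorem bracketForm_apply (ℓ : Module.Dual ℝ 𝔤) (x y : 𝔤) : bracketForm ℓ x y = ℓ ⁅x, y⁆ := rfl

theorem IsPolarization.radical_le [FiniteDimensional ℝ 𝔤] {ℓ : Module.Dual ℝ 𝔤}
    {p : LieSubalgebra ℝ 𝔤} (hp : IsPolarization ℓ p) : radical ℓ ≤ p.toSubmodule := by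
  have hrefl : (bracketForm ℓ).IsRefl := fun x y h => by
    rw [bracketForm_apply] at h ⊢
    rw [← lie_skew, map_neg, h, neg_zero]
  have h1 := LinearMap.BilinForm.finrank_add_finrank_orthogonal hrefl p.toSubmodule
  have hle : p.toSubmodule ≤ (bracketForm ℓ).orthogonal p.toSubmodule := by
    intro y hy x hx
    exact hp.1 x hx y hy
  have hrad : (bracketForm ℓ).orthogonal ⊤ = radical ℓ := by
    ext x
    constructor
    · intro h y
      have := h y trivial
      rw [bracketForm_apply] at this
      rw [← lie_skew, map_neg, this, neg_zero]
    · intro h y _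
      rw [bracketForm_apply, ← lie_skew, map_neg, h y, neg_zero]
  rw [hrad] at h1
  have h2 := Submodule.finrank_mono hle
  have h3 := hp.2
  have h5 : Module.finrank ℝ p = Module.finrank ℝ p.toSubmodule := rfl
  have h4 : p.toSubmodule ⊓ radical ℓ = radical ℓ :=
    Submodule.eq_of_le_of_finrank_le inf_le_right (by omega)
  exact inf_eq_right.mp h4

variable [IsTwoStep 𝔤]

theorem IsPolarization.lie_mem [FiniteDimensional ℝ 𝔤] {ℓ : Module.Dual ℝ 𝔤}
    {p : LieSubalgebra ℝ 𝔤} (hp : IsPolarization ℓ p) (x y : 𝔤) : ⁅x, y⁆ ∈ p :=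
  hp.radical_le fun z => by rw [lie_lie_left, map_zero]

/-- For the decomposition `x = S · Y` with `S ∈ 𝔰` and `Y ∈ p`, the number `ℓ(Y)`. -/
def phase (ℓ : Module.Dual ℝ 𝔤) {p : LieSubalgebra ℝ 𝔤} (c : Coords p) (x : Grp 𝔤) : ℝ :=
  ℓ (log ((exp (c.σ (c.τ (log x))))⁻¹ * x))

/-- The extension of `φ : 𝔰 → ℂ` to the function `ξ` on `G = 𝔰 · P` with
`ξ(S · Y) = χ_ℓ(-Y) φ(S)`, where `χ_ℓ(Y) = exp(-2πi ℓ(Y))`; it satisfies the covariance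
condition `ξ(g p) = conj (χ_ℓ(p)) ξ(g)`. -/
def covExt (ℓ : Module.Dual ℝ 𝔤) {p : LieSubalgebra ℝ 𝔤} (c : Coords p)
    (φ : (Fin c.m → ℝ) → ℂ) (x : Grp 𝔤) : ℂ :=
  (Real.fourierChar (phase ℓ c x) : ℂ) * φ (c.τ (log x))

/-- Left translation of covariant functions by `x`, read on `𝔰`. -/
def leftTranslate (ℓ : Module.Dual ℝ 𝔤) {p : LieSubalgebra ℝ 𝔤} (c : Coords p) (x : Grp 𝔤)
    (φ : (Fin c.m → ℝ) → ℂ) (r : Fin c.m → ℝ) : ℂ :=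
  covExt ℓ c φ (x⁻¹ * exp (c.σ r))

section Algebra

variable [FiniteDimensional ℝ 𝔤] {ℓ : Module.Dual ℝ 𝔤} {p : LieSubalgebra ℝ 𝔤}

theorem Coords.τ_eq_zero (c : Coords p) {y : 𝔤} : c.τ y = 0 ↔ y ∈ p := by
  rw [← LinearMap.mem_ker, c.ker_τ, LieSubalgebra.mem_toSubmodule]

theorem τ_log_mul (hp : IsPolarization ℓ p) (c : Coords p) (x y : Grp 𝔤) :
    c.τ (log (x * y)) = c.τ (log x) + c.τ (log y) := by
  rw [log_mul, map_add, map_add, map_smul, c.τ_eq_zero.2 (hp.lie_mem _ _), smul_zero, add_zero]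

theorem log_section_mem (hp : IsPolarization ℓ p) (c : Coords p) (x : Grp 𝔤) :
    log ((exp (c.σ (c.τ (log x))))⁻¹ * x) ∈ p := by
  rw [← c.τ_eq_zero, τ_log_mul hp, log_inv, log_exp, map_neg, c.τ_σ, neg_add_cancel]

theorem phase_mul (hp : IsPolarization ℓ p) (c : Coords p) (x : Grp 𝔤) {y : 𝔤} (hy : y ∈ p) :
    phase ℓ c (x * exp y) = phase ℓ c x + ℓ y := by
  have h : c.τ (log (x * exp y)) = c.τ (log x) := by
    rw [τ_log_mul hp, log_exp, c.τ_eq_zero.2 hy, add_zero]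
  rw [phase, phase, h, ← mul_assoc, log_mul _ (exp y), map_add, map_add, map_smul, log_exp,
    hp.1 _ (log_section_mem hp c x) _ hy, smul_zero, add_zero]

theorem covExt_mul (hp : IsPolarization ℓ p) (c : Coords p) (φ : (Fin c.m → ℝ) → ℂ) (x : Grp 𝔤)
    {y : 𝔤} (hy : y ∈ p) :
    covExt ℓ c φ (x * exp y) = (Real.fourierChar (ℓ y) : ℂ) * covExt ℓ c φ x := by
  rw [covExt, covExt, phase_mul hp c x hy, τ_log_mul hp, log_exp, c.τ_eq_zero.2 hy, add_zero,
    AddChar.map_add_eq_mul, Circle.coe_mul]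
  ring

theorem leftTranslate_mul (hp : IsPolarization ℓ p) (c : Coords p) (x y : Grp 𝔤)
    (φ : (Fin c.m → ℝ) → ℂ) :
    leftTranslate ℓ c (x * y) φ = leftTranslate ℓ c x (leftTranslate ℓ c y φ) := by
  funext r
  set z : Grp 𝔤 := x⁻¹ * exp (c.σ r) with hz
  have h1 : (x * y)⁻¹ * exp (c.σ r) = (y⁻¹ * exp (c.σ (c.τ (log z)))) *
      exp (log ((exp (c.σ (c.τ (log z))))⁻¹ * z)) := by
    rw [exp_log, hz]; group
  rw [leftTranslate, h1, covExt_mul hp c φ _ (log_section_mem hp c z)]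
  rfl

theorem leftTranslate_one (c : Coords p) (φ : (Fin c.m → ℝ) → ℂ) :
    leftTranslate ℓ c 1 φ = φ := by
  funext r
  simp [leftTranslate, covExt, phase, c.τ_σ]

theorem leftTranslate_apply (hp : IsPolarization ℓ p) (c : Coords p) (x : Grp 𝔤)
    (φ : (Fin c.m → ℝ) → ℂ) (r : Fin c.m → ℝ) :
    leftTranslate ℓ c x φ r =
      (Real.fourierChar (phase ℓ c (x⁻¹ * exp (c.σ r))) : ℂ) * φ (r - c.τ (log x)) := by
  rw [leftTranslate, covExt, τ_log_mul hp, log_inv, log_exp, map_neg, c.τ_σ, neg_add_eq_sub]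

end Algebra

section Topology

variable [TopologicalSpace 𝔤] [IsTopologicalAddGroup 𝔤] [ContinuousSMul ℝ 𝔤] [T2Space 𝔤]
  [FiniteDimensional ℝ 𝔤] {ℓ : Module.Dual ℝ 𝔤} {p : LieSubalgebra ℝ 𝔤}

theorem continuous_bracket : Continuous fun z : 𝔤 × 𝔤 => ⁅z.1, z.2⁆ := by
  let b := Module.finBasis ℝ 𝔤
  have h : (fun z : 𝔤 × 𝔤 => ⁅z.1, z.2⁆) =
      fun z => ∑ i, b.coord i z.1 • LieAlgebra.ad ℝ 𝔤 (b i) z.2 := by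
    funext z
    conv_lhs => rw [← b.sum_repr z.1]
    simp only [← lie_skew _ z.2, lie_sum, lie_smul, Module.Basis.coord_apply, LieAlgebra.ad_apply,
      smul_neg, Finset.sum_neg_distrib]
  rw [h]
  refine continuous_finsetSum _ fun i _ => Continuous.smul ?_ ?_
  · exact (LinearMap.continuous_of_finiteDimensional (b.coord i)).comp continuous_fst
  · exact (LinearMap.continuous_of_finiteDimensional (LieAlgebra.ad ℝ 𝔤 (b i))).comp continuous_snd

theorem continuous_log : Continuous (log : Grp 𝔤 → 𝔤) := continuous_id

theorem continuous_exp : Continuous (exp : 𝔤 → Grp 𝔤) := continuous_id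

theorem continuous_grp_inv : Continuous fun x : Grp 𝔤 => x⁻¹ :=
  continuous_exp.comp (continuous_neg.comp continuous_log)

theorem continuous_grp_mul : Continuous fun z : Grp 𝔤 × Grp 𝔤 => z.1 * z.2 := by
  have h1 : Continuous fun z : Grp 𝔤 × Grp 𝔤 => log z.1 := continuous_log.comp continuous_fst
  have h2 : Continuous fun z : Grp 𝔤 × Grp 𝔤 => log z.2 := continuous_log.comp continuous_snd
  exact continuous_exp.comp ((h1.add h2).add
    ((continuous_bracket.comp (h1.prodMk h2)).const_smul (1 / 2 : ℝ)))

theorem continuous_phase (ℓ : Module.Dual ℝ 𝔤) (c : Coords p) : Continuous (phase ℓ c) := by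
  have hτ := LinearMap.continuous_of_finiteDimensional c.τ
  have hσ := LinearMap.continuous_of_finiteDimensional c.σ
  have hℓ := LinearMap.continuous_of_finiteDimensional ℓ
  exact hℓ.comp (continuous_log.comp (continuous_grp_mul.comp
    ((continuous_grp_inv.comp (continuous_exp.comp
      (hσ.comp (hτ.comp continuous_log)))).prodMk continuous_id)))

/-- The unimodular factor of the left translation by `x` at `r`. -/
def factor (ℓ : Module.Dual ℝ 𝔤) (c : Coords p) (x : Grp 𝔤) (r : Fin c.m → ℝ) : ℂ :=
  (Real.fourierChar (phase ℓ c (x⁻¹ * exp (c.σ r))) : ℂ)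

theorem norm_factor (c : Coords p) (x : Grp 𝔤) (r : Fin c.m → ℝ) : ‖factor ℓ c x r‖ = 1 :=
  Circle.norm_coe _

theorem continuous_factor (ℓ : Module.Dual ℝ 𝔤) (c : Coords p) :
    Continuous fun z : Grp 𝔤 × (Fin c.m → ℝ) => factor ℓ c z.1 z.2 := by
  have hσ := LinearMap.continuous_of_finiteDimensional c.σ
  have h : Continuous fun z : Grp 𝔤 × (Fin c.m → ℝ) => z.1⁻¹ * exp (c.σ z.2) :=
    continuous_grp_mul.comp ((continuous_grp_inv.comp continuous_fst).prodMk
      (continuous_exp.comp (hσ.comp continuous_snd)))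
  exact continuous_subtype_val.comp
    (Real.continuous_fourierChar.comp ((continuous_phase ℓ c).comp h))

theorem continuous_factor_right (ℓ : Module.Dual ℝ 𝔤) (c : Coords p) (x : Grp 𝔤) :
    Continuous fun r => factor ℓ c x r :=
  Continuous.comp (g := fun z : Grp 𝔤 × (Fin c.m → ℝ) => factor ℓ c z.1 z.2)
    (f := fun r => (x, r)) (continuous_factor ℓ c) (continuous_const.prodMk continuous_id)

theorem continuous_factor_left (ℓ : Module.Dual ℝ 𝔤) (c : Coords p) (r : Fin c.m → ℝ) :
    Continuous fun x => factor ℓ c x r :=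
  Continuous.comp (g := fun z : Grp 𝔤 × (Fin c.m → ℝ) => factor ℓ c z.1 z.2)
    (f := fun x => (x, r)) (continuous_factor ℓ c) (continuous_id.prodMk continuous_const)

/-- `L²(𝔰)`, in the coordinates of `𝔰`. -/
abbrev IndSpace (c : Coords p) : Type := Lp ℂ 2 (volume : Measure (Fin c.m → ℝ))

theorem memLp_factor_mul (c : Coords p) (x : Grp 𝔤) {f : (Fin c.m → ℝ) → ℂ}
    (hf : MemLp f 2 volume) : MemLp (fun r => factor ℓ c x r * f r) 2 volume := by
  have hc := continuous_factor_right ℓ c x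
  refine hf.of_le (hc.aestronglyMeasurable.mul hf.1) (Eventually.of_forall fun r => ?_)
  rw [norm_mul, norm_factor, one_mul]

theorem memLp_leftTranslate (hp : IsPolarization ℓ p) (c : Coords p) (x : Grp 𝔤)
    {f : (Fin c.m → ℝ) → ℂ} (hf : MemLp f 2 volume) :
    MemLp (leftTranslate ℓ c x f) 2 volume := by
  have h1 : MemLp (fun r => f (r - c.τ (log x))) 2 volume :=
    hf.comp_measurePreserving (measurePreserving_sub_right volume (c.τ (log x)))
  have h := memLp_factor_mul (ℓ := ℓ) c x h1
  have h2 : leftTranslate ℓ c x f = fun r => factor ℓ c x r * f (r - c.τ (log x)) :=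
    funext (leftTranslate_apply hp c x f)
  rwa [h2]

theorem leftTranslate_congr (hp : IsPolarization ℓ p) (c : Coords p) (x : Grp 𝔤)
    {f g : (Fin c.m → ℝ) → ℂ} (h : f =ᵐ[volume] g) :
    leftTranslate ℓ c x f =ᵐ[volume] leftTranslate ℓ c x g := by
  have := (measurePreserving_sub_right volume (c.τ (log x))).quasiMeasurePreserving.ae_eq_comp h
  filter_upwards [this] with r hr
  rw [leftTranslate_apply hp, leftTranslate_apply hp]
  exact congrArg _ hr

/-- The left translation by `x` on `L²(𝔰)`. -/
def indOp (hp : IsPolarization ℓ p) (c : Coords p) (x : Grp 𝔤) (φ : IndSpace c) : IndSpace c :=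
  (memLp_leftTranslate hp c x (Lp.memLp φ)).toLp _

theorem coeFn_indOp (hp : IsPolarization ℓ p) (c : Coords p) (x : Grp 𝔤) (φ : IndSpace c) :
    indOp hp c x φ =ᵐ[volume] leftTranslate ℓ c x φ :=
  MemLp.coeFn_toLp _

theorem indOp_mul (hp : IsPolarization ℓ p) (c : Coords p) (x y : Grp 𝔤) (φ : IndSpace c) :
    indOp hp c (x * y) φ = indOp hp c x (indOp hp c y φ) := by
  apply Lp.ext
  refine (coeFn_indOp hp c _ φ).trans ?_
  rw [leftTranslate_mul hp]
  exact ((coeFn_indOp hp c x _).trans (leftTranslate_congr hp c x (coeFn_indOp hp c y φ))).symm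

theorem indOp_one (hp : IsPolarization ℓ p) (c : Coords p) (φ : IndSpace c) :
    indOp hp c 1 φ = φ := by
  apply Lp.ext
  refine (coeFn_indOp hp c _ φ).trans ?_
  rw [leftTranslate_one]

theorem indOp_add (hp : IsPolarization ℓ p) (c : Coords p) (x : Grp 𝔤) (φ ψ : IndSpace c) :
    indOp hp c x (φ + ψ) = indOp hp c x φ + indOp hp c x ψ := by
  apply Lp.ext
  refine (coeFn_indOp hp c _ _).trans ?_
  refine (leftTranslate_congr hp c x (Lp.coeFn_add φ ψ)).trans ?_
  filter_upwards [Lp.coeFn_add (indOp hp c x φ) (indOp hp c x ψ), coeFn_indOp hp c x φ,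
    coeFn_indOp hp c x ψ] with r h1 h2 h3
  rw [h1, Pi.add_apply, h2, h3]
  simp [leftTranslate, covExt, mul_add]

theorem indOp_smul (hp : IsPolarization ℓ p) (c : Coords p) (x : Grp 𝔤) (a : ℂ)
    (φ : IndSpace c) : indOp hp c x (a • φ) = a • indOp hp c x φ := by
  apply Lp.ext
  refine (coeFn_indOp hp c _ _).trans ?_
  refine (leftTranslate_congr hp c x (Lp.coeFn_smul a φ)).trans ?_
  filter_upwards [Lp.coeFn_smul a (indOp hp c x φ), coeFn_indOp hp c x φ] with r h1 h2
  rw [h1, Pi.smul_apply, h2]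
  simp only [leftTranslate, covExt, Pi.smul_apply, smul_eq_mul]
  ring

theorem indOp_eq (hp : IsPolarization ℓ p) (c : Coords p) (x : Grp 𝔤) (φ : IndSpace c) :
    indOp hp c x φ = (memLp_factor_mul (ℓ := ℓ) c x (Lp.memLp (Lp.compMeasurePreserving
      (fun r => r - c.τ (log x)) (measurePreserving_sub_right volume (c.τ (log x))) φ))).toLp _ := by
  apply Lp.ext
  refine (coeFn_indOp hp c x φ).trans (EventuallyEq.trans ?_ (MemLp.coeFn_toLp _).symm)
  filter_upwards [Lp.coeFn_compMeasurePreserving φ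
    (measurePreserving_sub_right volume (c.τ (log x)))] with r hr
  rw [leftTranslate_apply hp, hr]
  rfl

/-- Multiplication by the unimodular factor on `L²(𝔰)`. -/
def factorOp (ℓ : Module.Dual ℝ 𝔤) (c : Coords p) (x : Grp 𝔤) (ψ : IndSpace c) : IndSpace c :=
  (memLp_factor_mul (ℓ := ℓ) c x (Lp.memLp ψ)).toLp _

theorem factorOp_sub (c : Coords p) (x : Grp 𝔤) (ψ ψ' : IndSpace c) :
    factorOp ℓ c x (ψ - ψ') = factorOp ℓ c x ψ - factorOp ℓ c x ψ' := by
  rw [factorOp, factorOp, factorOp, ← MemLp.toLp_sub, MemLp.toLp_eq_toLp_iff]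
  filter_upwards [Lp.coeFn_sub ψ ψ'] with r hr
  rw [hr, Pi.sub_apply, Pi.sub_apply, mul_sub]

theorem norm_factorOp (c : Coords p) (x : Grp 𝔤) (ψ : IndSpace c) :
    ‖factorOp ℓ c x ψ‖ = ‖ψ‖ := by
  rw [factorOp, Lp.norm_toLp, Lp.norm_def]
  congr 1
  refine eLpNorm_congr_norm_ae (Eventually.of_forall fun r => ?_)
  rw [norm_mul, norm_factor, one_mul]

theorem norm_indOp (hp : IsPolarization ℓ p) (c : Coords p) (x : Grp 𝔤) (φ : IndSpace c) :
    ‖indOp hp c x φ‖ = ‖φ‖ := by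
  rw [indOp_eq]
  exact (norm_factorOp c x _).trans (Lp.norm_compMeasurePreserving _ _)

theorem firstCountable_grp : FirstCountableTopology (Grp 𝔤) := by
  let e := (Module.finBasis ℝ 𝔤).equivFun.toContinuousLinearEquiv
  exact e.toHomeomorph.isInducing.firstCountableTopology

theorem tendsto_factorOp (c : Coords p) (x₀ : Grp 𝔤) (ψ : IndSpace c) :
    Tendsto (fun x => factorOp ℓ c x ψ) (𝓝 x₀) (𝓝 (factorOp ℓ c x₀ ψ)) := by
  have := firstCountable_grp (𝔤 := 𝔤)
  have hc := continuous_factor_right ℓ c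
  have hfin : ∫⁻ r, (2 * ‖ψ r‖ₑ) ^ (2 : ℝ) ≠ ∞ := by
    have h := ((Lp.memLp ψ).const_mul (2 : ℂ)).eLpNorm_ne_top
    rw [eLpNorm_eq_lintegral_rpow_enorm_toReal two_ne_zero ENNReal.ofNat_ne_top] at h
    simp only [ENNReal.toReal_ofNat, enorm_mul] at h
    have h2 : ‖(2 : ℂ)‖ₑ = 2 := by
      rw [← ofReal_norm]; simp
    rw [h2] at h
    intro h'
    rw [h'] at h
    simp at h
  have key : Tendsto (fun x => ∫⁻ r, ‖factor ℓ c x r * ψ r - factor ℓ c x₀ r * ψ r‖ₑ ^ (2 : ℝ))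
      (𝓝 x₀) (𝓝 (∫⁻ _ : Fin c.m → ℝ, 0)) := by
    refine tendsto_lintegral_filter_of_dominated_convergence' _
      (Eventually.of_forall fun x => ?_) (Eventually.of_forall fun x => ?_) hfin ?_
    · exact ((((hc x).aestronglyMeasurable.mul (Lp.memLp ψ).1).sub
        ((hc x₀).aestronglyMeasurable.mul (Lp.memLp ψ).1)).enorm).pow_const _
    · refine Eventually.of_forall fun r => ENNReal.rpow_le_rpow ?_ zero_le_two
      refine (enorm_sub_le).trans (le_of_eq ?_)
      have h1 : ∀ x, ‖factor ℓ c x r‖ₑ = 1 := fun x => by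
        rw [← ofReal_norm, norm_factor, ENNReal.ofReal_one]
      rw [enorm_mul, enorm_mul, h1, h1, one_mul, two_mul]
    · refine Eventually.of_forall fun r => ?_
      have h1 : Continuous fun x => ‖factor ℓ c x r * ψ r - factor ℓ c x₀ r * ψ r‖ₑ ^ (2 : ℝ) := by
        have h2 := continuous_factor_left ℓ c r
        exact (ENNReal.continuous_rpow_const).comp
          (((h2.mul continuous_const).sub continuous_const).enorm)
      have h3 := h1.tendsto x₀
      simpa using h3
  refine (Lp.tendsto_Lp_iff_tendsto_eLpNorm'' _ _ _ _).2 ?_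
  simp only [eLpNorm_eq_lintegral_rpow_enorm_toReal two_ne_zero ENNReal.ofNat_ne_top,
    ENNReal.toReal_ofNat, Pi.sub_apply]
  rw [lintegral_zero] at key
  have h4 := ((ENNReal.continuous_rpow_const (y := (1 / 2 : ℝ))).tendsto 0).comp key
  rw [ENNReal.zero_rpow_of_pos (by norm_num)] at h4
  exact h4

/-- The translation by `τ(x)` on `L²(𝔰)`. -/
def transOp (c : Coords p) (x : Grp 𝔤) (φ : IndSpace c) : IndSpace c :=
  Lp.compMeasurePreserving (fun r => r - c.τ (log x))
    (measurePreserving_sub_right volume (c.τ (log x))) φ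

theorem continuous_transOp (c : Coords p) (φ : IndSpace c) :
    Continuous fun x => transOp c x φ := by
  have hτ := LinearMap.continuous_of_finiteDimensional c.τ
  let F : C(Grp 𝔤 × (Fin c.m → ℝ), Fin c.m → ℝ) :=
    ⟨fun z => z.2 - c.τ (log z.1),
      continuous_snd.sub (hτ.comp (continuous_log.comp continuous_fst))⟩
  exact Continuous.compMeasurePreservingLp (f := fun _ : Grp 𝔤 => φ) (g := F.curry)
    continuous_const F.curry.continuous
    (fun x => measurePreserving_sub_right volume (c.τ (log x))) ENNReal.ofNat_ne_top

theorem continuous_indOp (hp : IsPolarization ℓ p) (c : Coords p) (φ : IndSpace c) :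
    Continuous fun x => indOp hp c x φ := by
  have h0 : ∀ x, indOp hp c x φ = factorOp ℓ c x (transOp c x φ) := fun x => indOp_eq hp c x φ
  simp only [h0]
  rw [continuous_iff_continuousAt]
  intro x₀
  have h1 : Tendsto (fun x => factorOp ℓ c x (transOp c x φ - transOp c x₀ φ)) (𝓝 x₀) (𝓝 0) := by
    rw [tendsto_zero_iff_norm_tendsto_zero]
    simp only [norm_factorOp]
    rw [← tendsto_zero_iff_norm_tendsto_zero]
    simpa using ((continuous_transOp c φ).tendsto x₀).sub_const (transOp c x₀ φ)
  have h2 := h1.add (tendsto_factorOp (ℓ := ℓ) c x₀ (transOp c x₀ φ))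
  simp only [factorOp_sub, sub_add_cancel, zero_add] at h2
  exact h2

/-- The representation `ind_P^G χ_ℓ`, realized on `L²(𝔰)`. -/
def inducedRep (hp : IsPolarization ℓ p) (c : Coords p) : UnitaryRep (Grp 𝔤) where
  H := IndSpace c
  ρ :=
    { toFun := fun x =>
        { toFun := indOp hp c x
          invFun := indOp hp c x⁻¹
          map_add' := indOp_add hp c x
          map_smul' := indOp_smul hp c x
          left_inv := fun φ => by rw [← indOp_mul, inv_mul_cancel, indOp_one]
          right_inv := fun φ => by rw [← indOp_mul, mul_inv_cancel, indOp_one]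
          norm_map' := norm_indOp hp c x }
      map_one' := LinearIsometryEquiv.ext (indOp_one hp c)
      map_mul' := fun x y => LinearIsometryEquiv.ext (indOp_mul hp c x y) }
  continuous_apply := continuous_indOp hp c

/-- The unitary character `χ_q(x) = exp(-2πi q(x))` of `G`, for a character `q` of `𝔤`. -/
def unitaryChar (q : Module.Dual ℝ 𝔤) (hq : IsChar q) : Grp 𝔤 →* Circle where
  toFun x := Real.fourierChar (-q (log x))
  map_one' := by simp
  map_mul' x y := by
    rw [← AddChar.map_add_eq_mul, log_mul, map_add, map_add, map_smul, hq, smul_zero, add_zero,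
      neg_add]

theorem continuous_unitaryChar (q : Module.Dual ℝ 𝔤) (hq : IsChar q) :
    Continuous (unitaryChar q hq) :=
  Real.continuous_fourierChar.comp
    ((LinearMap.continuous_of_finiteDimensional q).comp continuous_log).neg

/-- `O` is the Kirillov orbit of `γ`: the class `γ` is that of `ind_P^G χ_ℓ` for some `ℓ ∈ O` and
some polarization in `ℓ`. -/
def IsKirillovOrbit (O : OrbitSpace 𝔤) (γ : UnitaryDual (Grp 𝔤)) : Prop :=
  ∃ ℓ ∈ O.orbit, ∃ (p : LieSubalgebra ℝ 𝔤) (hp : IsPolarization ℓ p) (c : Coords p),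
    γ.1 = ⟦inducedRep hp c⟧

end Topology

end Induced

end TwoStep

end

open TwoStep

noncomputable section

namespace TwoStep

open FourierTransform RealInnerProductSpace Real

/-! ### Gaussian vectors of Weyl systems -/

section Weyl

variable {E : Type*} [NormedAddCommGroup E] [InnerProductSpace ℝ E] [FiniteDimensional ℝ E]
  [MeasurableSpace E] [BorelSpace E]
  {H : Type*} [NormedAddCommGroup H] [InnerProductSpace ℂ H] [CompleteSpace H]

/-- A strongly continuous projective unitary representation of a Euclidean space `E` with the
multiplier given by the symplectic form `(s, t) ↦ ⟪s, J t⟫`, where `J` is orthogonal. -/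
structure IsWeylSystem (J : E →ₗ[ℝ] E) (W : E → H ≃ₗᵢ[ℂ] H) : Prop where
  norm_map : ∀ u, ‖J u‖ = ‖u‖
  skew : ∀ s t, ⟪s, J t⟫ = -⟪t, J s⟫
  mul : ∀ s t η, W s (W t η) = (fourierChar (-⟪s, J t⟫ / 2) : ℂ) • W (s + t) η
  continuous : ∀ η, Continuous fun s => W s η

/-- The Gaussian `exp(-π ‖s‖² / 2)`. -/
def gaussian (s : E) : ℝ := rexp (-(π / 2) * ‖s‖ ^ 2)

theorem continuous_gaussian : Continuous (gaussian : E → ℝ) := by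
  unfold gaussian; fun_prop

theorem gaussian_neg (s : E) : gaussian (-s) = gaussian s := by simp [gaussian]

theorem gaussian_pos (s : E) : 0 < gaussian s := exp_pos _

theorem integrable_gaussian : Integrable (gaussian : E → ℝ) := by
  have h := (GaussianFourier.integrable_cexp_neg_mul_sq_norm_add (V := E) (b := (π / 2 : ℝ))
    (by simp [pi_pos]) 0 0).re
  refine h.congr (Eventually.of_forall fun s => ?_)
  simp only [gaussian, zero_mul, add_zero]
  rw [← Complex.ofReal_neg, ← Complex.ofReal_pow, ← Complex.ofReal_mul, ← Complex.ofReal_exp]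
  exact Complex.ofReal_re _

namespace IsWeylSystem

variable {J : E →ₗ[ℝ] E} {W : E → H ≃ₗᵢ[ℂ] H}

theorem inner_self (hW : IsWeylSystem J W) (s : E) : ⟪s, J s⟫ = 0 := by
  linarith [hW.skew s s]

theorem zero_apply (hW : IsWeylSystem J W) (η : H) : W 0 η = η := by
  have h := hW.mul 0 0 η
  simp only [inner_zero_left, neg_zero, zero_div, AddChar.map_zero_eq_one, Circle.coe_one,
    one_smul, add_zero] at h
  exact (W 0).injective h

theorem inner_apply_left (hW : IsWeylSystem J W) (s : E) (η ζ : H) :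
    inner ℂ (W s η) ζ = inner ℂ η (W (-s) ζ) := by
  have h : W s (W (-s) ζ) = ζ := by
    rw [hW.mul]; simp [hW.inner_self, hW.zero_apply]
  conv_lhs => rw [← h]
  exact (W s).inner_map_map _ _

/-- The Gaussian mean `∫ exp(-π ‖s‖² / 2) W(s) η ds`. -/
def mean (W : E → H ≃ₗᵢ[ℂ] H) (η : H) : H := ∫ s, gaussian s • W s η

theorem integrable_mean (hW : IsWeylSystem J W) (η : H) :
    Integrable fun s => gaussian s • W s η := by
  refine (integrable_gaussian.smul_const ‖η‖).mono'
    (continuous_gaussian.smul (hW.continuous η)).aestronglyMeasurable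
    (Eventually.of_forall fun s => ?_)
  rw [norm_smul, LinearIsometryEquiv.norm_map, Real.norm_of_nonneg (gaussian_pos s).le, smul_eq_mul]

theorem inner_mean_left (hW : IsWeylSystem J W) (η ζ : H) :
    inner ℂ (mean W η) ζ = inner ℂ η (mean W ζ) := by
  have h1 : ∀ s, inner ℂ ζ (gaussian s • W s η) =
      (starRingEnd ℂ) (inner ℂ η (gaussian (-s) • W (-s) ζ)) := fun s => by
    rw [inner_conj_symm, gaussian_neg, ← Complex.coe_smul, ← Complex.coe_smul, inner_smul_right,
      inner_smul_left, Complex.conj_ofReal, ← inner_conj_symm, hW.inner_apply_left, inner_conj_symm]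
  rw [mean, mean, ← inner_conj_symm, ← integral_inner (hW.integrable_mean η)]
  simp only [h1]
  rw [integral_conj, Complex.conj_conj,
    integral_neg_eq_self (fun s => inner ℂ η (gaussian s • W s ζ)),
    integral_inner (hW.integrable_mean ζ)]

theorem apply_conj (hW : IsWeylSystem J W) (u s : E) (η : H) :
    W (-u) (W s (W u η)) = (fourierChar (-⟪s, J u⟫) : ℂ) • W s η := by
  rw [hW.mul s u, map_smul, hW.mul, smul_smul, ← Circle.coe_mul, ← AddChar.map_add_eq_mul]
  congr 3
  · rw [map_add, inner_add_right, inner_neg_left, inner_neg_left, hW.inner_self, hW.skew u s]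
    ring
  · abel

theorem exists_mean_ne_zero (hW : IsWeylSystem J W) [Nontrivial H] : ∃ η, mean W η ≠ 0 := by
  by_contra! h
  obtain ⟨η, hη⟩ := exists_ne (0 : H)
  set f : E → H := fun s => gaussian s • W s η
  have hfc : Continuous f := continuous_gaussian.smul (hW.continuous η)
  have hJ : Function.Surjective J := by
    refine LinearMap.injective_iff_surjective.1 ((injective_iff_map_eq_zero _).2 fun u hu => ?_)
    rw [← norm_eq_zero, ← hW.norm_map, hu, norm_zero]
  have hF : 𝓕 f = 0 := by
    funext y
    obtain ⟨u, rfl⟩ := hJ y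
    have h1 : W (-u) (mean W (W u η)) = 0 := by rw [h, map_zero]
    rw [mean, ← LinearIsometryEquiv.coe_toContinuousLinearEquiv,
      ← ContinuousLinearEquiv.integral_comp_comm] at h1
    rw [Real.fourier_eq, Pi.zero_apply, ← h1]
    refine integral_congr_ae (Eventually.of_forall fun s => ?_)
    simp only [f, LinearIsometryEquiv.coe_toContinuousLinearEquiv]
    rw [← Complex.coe_smul (gaussian s) (W s (W u η)), map_smul, hW.apply_conj, Circle.smul_def,
      Complex.coe_smul, smul_comm]
  have h2 := hfc.fourierInv_fourier_eq (hW.integrable_mean η)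
    (by rw [show 𝓕 f = 0 from hF]; exact integrable_zero _ _ _)
  have h3 : f 0 = 0 := by
    rw [← h2, show 𝓕 f = 0 from hF]
    simp [Real.fourierInv_eq]
  simp only [f, hW.zero_apply, smul_eq_zero, (gaussian_pos _).ne', false_or] at h3
  exact hη h3

theorem integral_gaussian_mul (hW : IsWeylSystem J W) (v w : E) :
    ∫ s, ((gaussian s * gaussian (w - v - s) : ℝ) : ℂ) *
      (fourierChar (-(⟪v, J w⟫ + ⟪s, J (v + w)⟫) / 2) : ℂ) = ((gaussian v * gaussian w : ℝ) : ℂ) := by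
  rw [← integral_add_right_eq_self _ ((1 / 2 : ℝ) • (w - v))]
  have h1 : ∀ s : E, ((gaussian (s + (1 / 2 : ℝ) • (w - v)) *
        gaussian (w - v - (s + (1 / 2 : ℝ) • (w - v))) : ℝ) : ℂ) *
      (fourierChar (-(⟪v, J w⟫ + ⟪s + (1 / 2 : ℝ) • (w - v), J (v + w)⟫) / 2) : ℂ) =
      (rexp (-(π / 4) * ‖w - v‖ ^ 2) : ℂ) *
        (fourierChar (-⟪s, J ((1 / 2 : ℝ) • (v + w))⟫) • Complex.exp (-(π : ℂ) * ‖s‖ ^ 2)) := by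
    intro s
    have e1 : w - v - (s + (1 / 2 : ℝ) • (w - v)) = -(s - (1 / 2 : ℝ) • (w - v)) := by module
    have e2 : gaussian (s + (1 / 2 : ℝ) • (w - v)) * gaussian (s - (1 / 2 : ℝ) • (w - v)) =
        rexp (-(π / 4) * ‖w - v‖ ^ 2) * rexp (-π * ‖s‖ ^ 2) := by
      rw [gaussian, gaussian, ← Real.exp_add, ← Real.exp_add, norm_add_sq_real, norm_sub_sq_real,
        norm_smul]
      congr 1
      norm_num
      ring
    have e3 : -(⟪v, J w⟫ + ⟪s + (1 / 2 : ℝ) • (w - v), J (v + w)⟫) / 2 =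
        -⟪s, J ((1 / 2 : ℝ) • (v + w))⟫ := by
      simp only [map_add, map_smul, inner_add_left, inner_add_right, inner_smul_left,
        inner_smul_right, inner_sub_left, hW.inner_self, hW.skew w v]
      simp
      ring
    rw [e1, gaussian_neg, e2, e3, Circle.smul_def]
    push_cast
    rw [smul_eq_mul]
    ring
  simp only [h1]
  rw [integral_const_mul, ← Real.fourier_eq, fourier_gaussian_innerProductSpace (by simp [pi_pos]),
    div_self (by simp [pi_ne_zero]), Complex.one_cpow, one_mul, hW.norm_map, gaussian, gaussian,
    ← Real.exp_add]
  have e4 : -(π : ℂ) ^ 2 * (‖(1 / 2 : ℝ) • (v + w)‖ : ℂ) ^ 2 / π =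
      ((-π * ‖(1 / 2 : ℝ) • (v + w)‖ ^ 2 : ℝ) : ℂ) := by
    have : (π : ℂ) ≠ 0 := by simp [pi_ne_zero]
    push_cast
    field_simp
  rw [e4, ← Complex.ofReal_exp, ← Complex.ofReal_mul, ← Real.exp_add]
  congr 2
  rw [norm_smul, mul_pow, norm_add_sq_real, norm_sub_sq_real, real_inner_comm]
  norm_num
  ring

theorem mean_apply_mean (hW : IsWeylSystem J W) (v : E) (η : H) :
    mean W (W v (mean W η)) = gaussian v • mean W η := by
  have h1 : ∀ s, gaussian s • W s (W v (mean W η)) = ∫ w, (((gaussian s * gaussian (w - v - s) : ℝ) : ℂ)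
      * (fourierChar (-(⟪v, J w⟫ + ⟪s, J (v + w)⟫) / 2) : ℂ)) • W w η := by
    intro s
    rw [mean, ← LinearIsometryEquiv.coe_toContinuousLinearEquiv (W v),
      ← ContinuousLinearEquiv.integral_comp_comm,
      ← LinearIsometryEquiv.coe_toContinuousLinearEquiv (W s),
      ← ContinuousLinearEquiv.integral_comp_comm, ← integral_smul,
      ← integral_sub_right_eq_self _ (v + s)]
    refine integral_congr_ae (Eventually.of_forall fun w => ?_)
    simp only [LinearIsometryEquiv.coe_toContinuousLinearEquiv]
    rw [← Complex.coe_smul _ (W (w - (v + s)) η), map_smul, map_smul, hW.mul v, map_smul, hW.mul,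
      ← Complex.coe_smul, smul_smul, smul_smul, smul_smul]
    have e1 : s + (v + (w - (v + s))) = w := by abel
    rw [e1]
    congr 1
    have e2 : -(⟪v, J w⟫ + ⟪s, J (v + w)⟫) / 2 = -⟪v, J (w - (v + s))⟫ / 2 +
        -⟪s, J (v + (w - (v + s)))⟫ / 2 := by
      simp only [map_add, map_sub, inner_add_right, inner_sub_right, hW.inner_self, hW.skew v s]
      ring
    rw [e2, AddChar.map_add_eq_mul, Circle.coe_mul, sub_sub]
    push_cast
    ring
  have hint : Integrable (Function.uncurry fun s w => (((gaussian s * gaussian (w - v - s) : ℝ) : ℂ)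
      * (fourierChar (-(⟪v, J w⟫ + ⟪s, J (v + w)⟫) / 2) : ℂ)) • W w η)
      ((volume : Measure E).prod volume) := by
    have hJc : Continuous J := J.continuous_of_finiteDimensional
    have hfc : Continuous fun x => (fourierChar x : ℂ) :=
      continuous_subtype_val.comp Real.continuous_fourierChar
    have hWc := hW.continuous η
    have hcont : Continuous (Function.uncurry fun s w => (((gaussian s * gaussian (w - v - s) : ℝ) : ℂ)
      * (fourierChar (-(⟪v, J w⟫ + ⟪s, J (v + w)⟫) / 2) : ℂ)) • W w η) := by
      simp only [Function.uncurry_def]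
      refine (Continuous.mul ?_ (hfc.comp ?_)).smul (hWc.comp continuous_snd)
      · exact Complex.continuous_ofReal.comp ((continuous_gaussian.comp continuous_fst).mul
          (continuous_gaussian.comp (by fun_prop)))
      · fun_prop
    have hg : Integrable (fun z : E × E => gaussian z.1 * gaussian (z.2 - v - z.1) * ‖η‖)
        ((volume : Measure E).prod volume) := by
      refine Integrable.mul_const ?_ _
      refine (integrable_prod_iff (by
        refine Continuous.aestronglyMeasurable ?_
        exact (continuous_gaussian.comp continuous_fst).mul
          (continuous_gaussian.comp (by fun_prop)))).2 ⟨Eventually.of_forall fun s => ?_, ?_⟩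
      · have := integrable_gaussian.comp_sub_right (μ := (volume : Measure E)) (v + s)
        simpa only [sub_sub] using this.const_mul (gaussian s)
      · have h2 : ∀ s : E, ∫ w, ‖gaussian s * gaussian (w - v - s)‖ =
            gaussian s * ∫ w, gaussian (w : E) := fun s => by
          rw [← integral_sub_right_eq_self (fun w => gaussian w) (v + s), ← integral_const_mul]
          refine integral_congr_ae (Eventually.of_forall fun w => ?_)
          simp only [sub_sub]
          exact Real.norm_of_nonneg (mul_pos (gaussian_pos _) (gaussian_pos _)).le
        simp only [h2]
        exact integrable_gaussian.mul_const _
    refine hg.mono' hcont.aestronglyMeasurable (Eventually.of_forall fun z => ?_)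
    simp only [Function.uncurry_def]
    rw [norm_smul, norm_mul, Circle.norm_coe, mul_one, LinearIsometryEquiv.norm_map,
      Complex.norm_real, Real.norm_of_nonneg (mul_pos (gaussian_pos _) (gaussian_pos _)).le]
  rw [mean]
  simp only [h1]
  rw [integral_integral_swap hint]
  simp only [integral_smul_const, hW.integral_gaussian_mul]
  rw [mean, ← integral_smul]
  simp only [Complex.coe_smul, mul_smul]

/-- Every Weyl system on a non-zero space has a unit vector with a Gaussian coefficient. -/
theorem exists_gaussian_vector (hW : IsWeylSystem J W) [Nontrivial H] :
    ∃ ξ : H, ‖ξ‖ = 1 ∧ ∀ v, inner ℂ ξ (W v ξ) = (gaussian v : ℂ) := by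
  obtain ⟨η, hη⟩ := hW.exists_mean_ne_zero
  have key : ∀ v, inner ℂ (mean W η) (W v (mean W η)) = (gaussian v : ℂ) * inner ℂ η (mean W η) := by
    intro v
    rw [hW.inner_mean_left, hW.mean_apply_mean, ← Complex.coe_smul, inner_smul_right]
  have h0 := key 0
  rw [hW.zero_apply, show gaussian (0 : E) = 1 by simp [gaussian], Complex.ofReal_one, one_mul] at h0
  have hn : (‖mean W η‖ : ℂ) ≠ 0 := by simpa using hη
  refine ⟨((‖mean W η‖ : ℂ)⁻¹) • mean W η, ?_, fun v => ?_⟩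
  · rw [norm_smul, norm_inv, Complex.norm_real, norm_norm, inv_mul_cancel₀ (norm_ne_zero_iff.2 hη)]
  · rw [map_smul, inner_smul_left, inner_smul_right, key, ← h0, inner_self_eq_norm_sq_to_K,
      map_inv₀, Complex.conj_ofReal]
    simp only [Complex.coe_algebraMap]
    field_simp

end IsWeylSystem

end Weyl

end TwoStep

end

noncomputable section

namespace TwoStep

section Fourier

open FourierTransform RealInnerProductSpace Real

/-! ### Injectivity of the Fourier transform on `L¹` -/

theorem ae_eq_zero_of_integral_fourierChar_inner {E : Type*} [NormedAddCommGroup E]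
    [InnerProductSpace ℝ E] [FiniteDimensional ℝ E] [MeasurableSpace E] [BorelSpace E] {h : E → ℂ}
    (hh : Integrable h) (h0 : ∀ w, ∫ v, (fourierChar ⟪v, w⟫ : ℂ) * h v = 0) : h =ᵐ[volume] 0 := by
  refine ae_eq_zero_of_integral_contDiff_smul_eq_zero hh.locallyIntegrable fun g hg hgc => ?_
  have hgc' : HasCompactSupport fun x => (g x : ℂ) := hgc.comp_left (g := fun t : ℝ => (t : ℂ)) rfl
  have hg' : ContDiff ℝ (⊤ : ℕ∞) fun x => (g x : ℂ) := Complex.ofRealCLM.contDiff.comp hg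
  set G : SchwartzMap E ℂ := hgc'.toSchwartzMap hg'
  have hG : 𝓕 (𝓕⁻ G) = G := fourier_fourierInv_eq G
  have h1 := VectorFourier.integral_fourierIntegral_smul_eq_flip (L := innerₗ E)
    (μ := volume) (ν := volume) Real.continuous_fourierChar continuous_inner
    (𝓕⁻ G).integrable hh
  have h2 : VectorFourier.fourierIntegral fourierChar volume (innerₗ E).flip h = 0 := by
    funext w
    have := h0 (-w)
    simp only [VectorFourier.fourierIntegral, flip_innerₗ, innerₗ_apply_apply, Pi.zero_apply]
    rw [← this]
    simp [Circle.smul_def]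
  rw [h2] at h1
  simp only [Pi.zero_apply, smul_zero, integral_zero] at h1
  rw [← h1]
  refine integral_congr_ae (Eventually.of_forall fun x => ?_)
  have h3 : VectorFourier.fourierIntegral fourierChar volume (innerₗ E)
      (𝓕⁻ G : SchwartzMap E ℂ) x = (g x : ℂ) := by
    have : (𝓕 (𝓕⁻ G)) x = G x := by rw [hG]
    rw [SchwartzMap.fourier_coe] at this
    exact this
  simp only [h3]
  exact (Complex.coe_smul _ _).symm

theorem ae_eq_zero_of_integral_fourierChar_dual {n : ℕ} {h : (Fin n → ℝ) → ℂ}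
    (hh : Integrable h)
    (h0 : ∀ L : (Fin n → ℝ) →ₗ[ℝ] ℝ, ∫ v, (fourierChar (L v) : ℂ) * h v = 0) :
    h =ᵐ[volume] 0 := by
  have hmp := PiLp.volume_preserving_ofLp (Fin n)
  have hme := (MeasurableEquiv.toLp 2 (Fin n → ℝ)).symm.measurableEmbedding
  have h1 : (fun v : EuclideanSpace ℝ (Fin n) => h (WithLp.ofLp v)) =ᵐ[volume] 0 := by
    refine ae_eq_zero_of_integral_fourierChar_inner
      ((hmp.integrable_comp_emb hme).2 hh) fun w => ?_
    have h2 := h0 ((innerₗ (EuclideanSpace ℝ (Fin n)) w) ∘ₗ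
      (WithLp.linearEquiv 2 ℝ (Fin n → ℝ)).symm.toLinearMap)
    rw [← hmp.integral_comp hme] at h2
    rw [← h2]
    refine integral_congr_ae (Eventually.of_forall fun v => ?_)
    simp only [LinearMap.comp_apply, innerₗ_apply_apply]
    rw [real_inner_comm]
    rfl
  have h3 := (PiLp.volume_preserving_toLp (Fin n)).quasiMeasurePreserving.ae_eq_comp h1
  exact h3

/-! ### Continuous characters of vector spaces -/

theorem exists_real_of_character {θ : ℝ → ℂ} (hc : Continuous θ) (hm : ∀ s t, θ (s + t) = θ s * θ t)
    (hn : ∀ s, ‖θ s‖ = 1) : ∃ a : ℝ, ∀ t, θ t = (fourierChar (a * t) : ℂ) := by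
  have h0 : θ 0 = 1 := by
    have h := hm 0 0
    rw [add_zero] at h
    exact (mul_eq_left₀ (norm_ne_zero_iff.1 (by simp [hn]))).1 h.symm
  set F : ℝ → ℂ := fun a => ∫ s in (0 : ℝ)..a, θ s with hF
  have hFd : ∀ a, HasDerivAt F (θ a) a := fun a => hc.integral_hasStrictDerivAt 0 a |>.hasDerivAt
  obtain ⟨a, ha⟩ : ∃ a, F a ≠ 0 := by
    by_contra! h
    have h1 := hFd 0
    rw [show F = fun _ => 0 from funext h] at h1
    have := h1.unique (hasDerivAt_const _ _)
    rw [h0] at this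
    exact one_ne_zero this
  have h1 : ∀ t, θ t = (F (t + a) - F t) / F a := by
    intro t
    rw [eq_div_iff ha]
    have e1 : F (t + a) - F t = ∫ s in t..(t + a), θ s :=
      intervalIntegral.integral_interval_sub_left (hc.intervalIntegrable _ _)
        (hc.intervalIntegrable _ _)
    have e2 := intervalIntegral.integral_comp_add_left (a := 0) (b := a) θ t
    rw [add_zero] at e2
    rw [e1, ← e2]
    simp only [hm]
    rw [intervalIntegral.integral_const_mul]
  set c : ℂ := (θ a - 1) / F a
  have h2 : ∀ t, HasDerivAt θ (c * θ t) t := by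
    intro t
    have e := (((hFd (t + a)).comp_add_const t a).sub (hFd t)).div_const (F a)
    rw [show θ = fun t => (F (t + a) - F t) / F a from funext h1]
    refine e.congr_deriv ?_
    simp only [← h1 t, hm, c]
    ring
  have h3 : ∀ t, θ t = Complex.exp (c * t) := by
    have e1 : ∀ t : ℝ, HasDerivAt (fun t : ℝ => θ t * Complex.exp (-(c * t))) 0 t := by
      intro t
      have e2 : HasDerivAt (fun t : ℝ => Complex.exp (-(c * t))) (Complex.exp (-(c * t)) * -(c * 1)) t :=
        (((hasDerivAt_id (t : ℂ)).const_mul c).neg.cexp).comp_ofReal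
      refine ((h2 t).mul e2).congr_deriv ?_
      ring
    have e3 := is_const_of_deriv_eq_zero (fun t => (e1 t).differentiableAt) (fun t => (e1 t).deriv)
    intro t
    have e4 := e3 t 0
    simp only [Complex.ofReal_zero, mul_zero, neg_zero, Complex.exp_zero, mul_one, h0] at e4
    rw [Complex.exp_neg] at e4
    field_simp at e4
    exact e4
  have h4 : c.re = 0 := by
    have := hn 1
    rw [h3, Complex.norm_exp] at this
    simpa using this
  refine ⟨c.im / (2 * π), fun t => ?_⟩
  rw [h3, Real.fourierChar_apply]
  congr 1
  have : c = c.im * Complex.I := by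
    apply Complex.ext <;> simp [h4]
  rw [this]
  have hpi : (π : ℂ) ≠ 0 := by simp [pi_ne_zero]
  push_cast
  simp
  field_simp

theorem exists_dual_of_character {V : Type*} [AddCommGroup V] [Module ℝ V] [FiniteDimensional ℝ V]
    [TopologicalSpace V] [IsTopologicalAddGroup V] [ContinuousSMul ℝ V] {θ : V → ℂ}
    (hc : Continuous θ) (hm : ∀ s t, θ (s + t) = θ s * θ t) (hn : ∀ s, ‖θ s‖ = 1) :
    ∃ μ : Module.Dual ℝ V, ∀ x, θ x = (fourierChar (-μ x) : ℂ) := by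
  have h0 : θ 0 = 1 := by
    have h := hm 0 0
    rw [add_zero] at h
    exact (mul_eq_left₀ (norm_ne_zero_iff.1 (by simp [hn]))).1 h.symm
  let b := Module.finBasis ℝ V
  have h1 : ∀ i, ∃ a : ℝ, ∀ t : ℝ, θ (t • b i) = (fourierChar (a * t) : ℂ) := fun i =>
    exists_real_of_character (hc.comp (by fun_prop)) (fun s t => by rw [add_smul, hm])
      fun s => hn _
  choose a ha using h1
  refine ⟨-∑ i, a i • b.coord i, fun x => ?_⟩
  have h2 : ∀ (s : Finset (Fin (Module.finrank ℝ V))) (y : Fin (Module.finrank ℝ V) → V),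
      θ (∑ i ∈ s, y i) = ∏ i ∈ s, θ (y i) := by
    intro s y
    induction s using Finset.cons_induction with
    | empty => simp [h0]
    | cons i s hi ih => rw [Finset.sum_cons, Finset.prod_cons, hm, ih]
  have h3 : ∀ (s : Finset (Fin (Module.finrank ℝ V))) (y : Fin (Module.finrank ℝ V) → ℝ),
      (fourierChar (∑ i ∈ s, y i) : ℂ) = ∏ i ∈ s, (fourierChar (y i) : ℂ) := by
    intro s y
    induction s using Finset.cons_induction with
    | empty => simp
    | cons i s hi ih => rw [Finset.sum_cons, Finset.prod_cons, AddChar.map_add_eq_mul,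
        Circle.coe_mul, ih]
  conv_lhs => rw [← b.sum_repr x]
  rw [h2]
  simp only [ha]
  rw [← h3]
  simp

end Fourier

/-! ### Irreducible representations -/

section Irreducible

variable {G : Type*} [Group G] [TopologicalSpace G]

namespace UnitaryRep

/-- Linear combinations of the translates of a vector. -/
def orbitMap (π : UnitaryRep G) (ξ : π.H) : (G →₀ ℂ) →ₗ[ℂ] π.H :=
  Finsupp.linearCombination ℂ fun x => π.ρ x ξ

theorem orbitMap_single (π : UnitaryRep G) (ξ : π.H) (x : G) :
    π.orbitMap ξ (Finsupp.single x 1) = π.ρ x ξ := by simp [orbitMap]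

theorem rho_orbitMap (π : UnitaryRep G) (ξ : π.H) (x : G) (f : G →₀ ℂ) :
    π.ρ x (π.orbitMap ξ f) = π.orbitMap ξ (f.mapDomain fun y => x * y) := by
  rw [orbitMap, Finsupp.linearCombination_mapDomain, Finsupp.linearCombination_apply,
    Finsupp.linearCombination_apply, Finsupp.sum, Finsupp.sum, map_sum]
  simp [Function.comp_def]

theorem rho_mul_apply (π : UnitaryRep G) (x y : G) (ξ : π.H) :
    π.ρ (x * y) ξ = π.ρ x (π.ρ y ξ) := by
  rw [map_mul]; rfl

theorem inner_rho_left (π : UnitaryRep G) (x : G) (ξ η : π.H) :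
    Inner.inner ℂ (π.ρ x ξ) η = Inner.inner ℂ ξ (π.ρ x⁻¹ η) := by
  have h : π.ρ x (π.ρ x⁻¹ η) = η := by
    rw [← rho_mul_apply, mul_inv_cancel, map_one, LinearIsometryEquiv.coe_one, id]
  conv_lhs => rw [← h]
  exact (π.ρ x).inner_map_map _ _

theorem inner_orbitMap (π : UnitaryRep G) (ξ : π.H) (f : G →₀ ℂ) (x : G) :
    Inner.inner ℂ (π.orbitMap ξ f) (π.ρ x (π.orbitMap ξ f)) =
      ∑ y ∈ f.support, ∑ z ∈ f.support, (starRingEnd ℂ) (f y) * f z *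
        Inner.inner ℂ ξ (π.ρ (y⁻¹ * x * z) ξ) := by
  rw [orbitMap, Finsupp.linearCombination_apply, Finsupp.sum, map_sum, sum_inner]
  simp only [inner_sum, map_smul, inner_smul_left, inner_smul_right, inner_rho_left]
  refine Finset.sum_congr rfl fun y _ => Finset.sum_congr rfl fun z _ => ?_
  rw [mul_assoc y⁻¹, rho_mul_apply, rho_mul_apply]
  ring

theorem IsIrreducible.denseRange_orbitMap {π : UnitaryRep G} (hπ : π.IsIrreducible) {ξ : π.H}
    (hξ : ξ ≠ 0) : DenseRange (π.orbitMap ξ) := by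
  have h := hπ.2 (LinearMap.range (π.orbitMap ξ)).topologicalClosure
    (Submodule.isClosed_topologicalClosure _) (fun x η hη => by
      refine map_mem_closure (π.ρ x).continuous hη ?_
      rintro _ ⟨f, rfl⟩
      exact ⟨_, (π.rho_orbitMap ξ x f).symm⟩)
  rcases h with h | h
  · refine absurd ?_ hξ
    have : ξ ∈ (LinearMap.range (π.orbitMap ξ)).topologicalClosure :=
      Submodule.le_topologicalClosure _ ⟨Finsupp.single 1 1, by simp [orbitMap_single]⟩
    rwa [h, Submodule.mem_bot] at this
  · exact fun η => by
      have : η ∈ (LinearMap.range (π.orbitMap ξ)).topologicalClosure := by rw [h]; trivial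
      exact this

/-- Irreducible representations with a common non-zero coefficient of positive type are
equivalent. -/
theorem IsIrreducible.equivalent_of_coeff_eq {π π' : UnitaryRep G} (hπ : π.IsIrreducible)
    (hπ' : π'.IsIrreducible) {ξ : π.H} {ξ' : π'.H} (hξ : ξ ≠ 0) (hξ' : ξ' ≠ 0)
    (h : ∀ x, Inner.inner ℂ ξ (π.ρ x ξ) = Inner.inner ℂ ξ' (π'.ρ x ξ')) : Equivalent π π' := by
  have hn : ∀ f, ‖π'.orbitMap ξ' f‖ = ‖π.orbitMap ξ f‖ := by
    intro f
    have h1 := π.inner_orbitMap ξ f 1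
    have h2 := π'.inner_orbitMap ξ' f 1
    simp only [h] at h1
    rw [← h2, map_one, map_one] at h1
    simp only [LinearIsometryEquiv.coe_one, id] at h1
    rw [inner_self_eq_norm_sq_to_K, inner_self_eq_norm_sq_to_K] at h1
    have h3 : ‖π.orbitMap ξ f‖ ^ 2 = ‖π'.orbitMap ξ' f‖ ^ 2 := by exact_mod_cast h1
    exact ((sq_eq_sq₀ (norm_nonneg _) (norm_nonneg _)).1 h3).symm
  have hd := hπ.denseRange_orbitMap hξ
  have hd' := hπ'.denseRange_orbitMap hξ'
  set U : π.H ≃ₗᵢ[ℂ] π'.H := LinearEquiv.extendOfIsometry (LinearEquiv.refl ℂ (G →₀ ℂ))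
    (π.orbitMap ξ) (π'.orbitMap ξ') hd hd' hn
  have hU : ∀ f, U (π.orbitMap ξ f) = π'.orbitMap ξ' f :=
    LinearEquiv.extendOfIsometry_eq (LinearEquiv.refl ℂ (G →₀ ℂ)) _ _ hd hd' hn
  refine ⟨U, fun x η => ?_⟩
  refine hd.induction_on (p := fun η => U (π.ρ x η) = π'.ρ x (U η)) η
    (isClosed_eq ?_ ?_) fun f => ?_
  · exact (LinearIsometryEquiv.continuous _).comp (LinearIsometryEquiv.continuous _)
  · exact (LinearIsometryEquiv.continuous _).comp (LinearIsometryEquiv.continuous _)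
  · rw [rho_orbitMap, hU, hU, rho_orbitMap]

/-- Schur's lemma for unitary operators. -/
theorem IsIrreducible.exists_scalar_of_commute {π : UnitaryRep G} (hπ : π.IsIrreducible)
    (U : π.H ≃ₗᵢ[ℂ] π.H) (hU : ∀ x ξ, U (π.ρ x ξ) = π.ρ x (U ξ)) :
    ∃ z : ℂ, ∀ ξ, U ξ = z • ξ := by
  have := hπ.1
  set a : π.H →L[ℂ] π.H := (U : π.H →L[ℂ] π.H) with ha
  have hstar : star a = ((U.symm : π.H ≃ₗᵢ[ℂ] π.H) : π.H →L[ℂ] π.H) := by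
    rw [ContinuousLinearMap.star_eq_adjoint]
    exact U.adjoint_eq_symm
  have hnorm : IsStarNormal a := ⟨by
    rw [hstar]; ext ξ; simp [ha, mul_apply_eq_comp]⟩
  have hcomm : ∀ (f : ℂ → ℂ) (x : G) (ξ : π.H), cfc f a (π.ρ x ξ) = π.ρ x (cfc f a ξ) := by
    intro f x ξ
    have h1 : Commute a (π.ρ x : π.H →L[ℂ] π.H) := by
      ext ξ; simpa [ha, mul_apply_eq_comp] using hU x ξ
    have h2 : Commute (star a) (π.ρ x : π.H →L[ℂ] π.H) := by
      rw [hstar]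
      ext ξ
      simp only [mul_apply_eq_comp]
      change U.symm (π.ρ x ξ) = π.ρ x (U.symm ξ)
      rw [LinearIsometryEquiv.symm_apply_eq, hU, LinearIsometryEquiv.apply_symm_apply]
    exact congrArg (fun T : π.H →L[ℂ] π.H => T ξ) (h1.cfc h2 f).eq
  obtain ⟨z, hz⟩ := spectrum.nonempty a
  have hsub : ∀ w ∈ spectrum ℂ a, w = z := by
    intro w hw
    by_contra hne
    set δ : ℝ := ‖w - z‖ / 2
    have hδ : 0 < δ := half_pos (norm_pos_iff.2 (sub_ne_zero.2 hne))
    let bump : ℂ → ℂ → ℂ := fun y t => ((max 0 (δ - ‖t - y‖) : ℝ) : ℂ)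
    have hbc : ∀ y, Continuous (bump y) := fun y => by
      simp only [bump]; fun_prop
    have hb0 : ∀ y ∈ spectrum ℂ a, cfc (bump y) a ≠ 0 := by
      intro y hy h0
      have h1 := cfc_map_spectrum (R := ℂ) (bump y) a hnorm (hbc y).continuousOn
      rw [h0, spectrum.zero_eq] at h1
      have h2 : bump y y ∈ ({0} : Set ℂ) := h1 ▸ ⟨y, hy, rfl⟩
      simp only [bump, sub_self, norm_zero, sub_zero, Set.mem_singleton_iff,
        Complex.ofReal_eq_zero] at h2
      rw [max_eq_right hδ.le] at h2
      exact hδ.ne' h2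
    have hmul : cfc (bump z) a * cfc (bump w) a = 0 := by
      rw [← cfc_mul (bump z) (bump w) a (hbc z).continuousOn (hbc w).continuousOn]
      have : (fun t => bump z t * bump w t) = fun _ => 0 := by
        funext t
        have ht : ‖w - z‖ ≤ ‖t - z‖ + ‖t - w‖ := by
          rw [show w - z = (t - z) - (t - w) by ring]
          exact norm_sub_le _ _
        simp only [bump, mul_eq_zero, Complex.ofReal_eq_zero, max_eq_left_iff]
        by_contra! h
        simp only [δ] at h
        linarith [h.1, h.2]
      rw [this, cfc_const_zero]
    rcases hπ.2 (LinearMap.ker (cfc (bump z) a).toLinearMap) (cfc (bump z) a).isClosed_ker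
      (fun x ξ hξ => by
        have h1 : cfc (bump z) a ξ = 0 := hξ
        change cfc (bump z) a (π.ρ x ξ) = 0
        rw [hcomm, h1, map_zero]) with h | h
    · refine hb0 w hw (ContinuousLinearMap.ext fun ξ => ?_)
      have h1 : cfc (bump w) a ξ ∈ LinearMap.ker (cfc (bump z) a).toLinearMap :=
        congrArg (fun T : π.H →L[ℂ] π.H => T ξ) hmul
      rwa [h, Submodule.mem_bot] at h1
    · refine hb0 z hz (ContinuousLinearMap.ext fun ξ => ?_)
      have h1 : ξ ∈ LinearMap.ker (cfc (bump z) a).toLinearMap := by rw [h]; trivial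
      exact h1
  have haz : a = algebraMap ℂ (π.H →L[ℂ] π.H) z := by
    rw [← cfc_const z a hnorm, ← cfc_congr (f := id) fun w hw => hsub w hw, cfc_id ℂ a hnorm]
  refine ⟨z, fun ξ => ?_⟩
  have := congrArg (fun T : π.H →L[ℂ] π.H => T ξ) haz
  simpa [ha, Algebra.algebraMap_eq_smul_one] using this

theorem IsIrreducible.twist {π : UnitaryRep G} (hπ : π.IsIrreducible) (χ : G →* Circle)
    (hχ : Continuous χ) : (π.twist χ hχ).IsIrreducible := by
  refine ⟨hπ.1, fun K hK hinv => hπ.2 K hK fun x ξ hξ => ?_⟩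
  have h : (χ x : ℂ) • π.ρ x ξ ∈ K := hinv x ξ hξ
  exact (K.smul_mem_iff (Circle.coe_ne_zero (χ x))).1 h

end UnitaryRep

end Irreducible

end TwoStep

end

noncomputable section

namespace TwoStep

open Grp

/-! ### The absolute value of a skew-symmetric operator -/

section AbsForm

open RealInnerProductSpace

variable {E : Type*} [NormedAddCommGroup E] [InnerProductSpace ℝ E] [FiniteDimensional ℝ E]

/-- The operator `J* J`. -/
def gram (J : E →L[ℝ] E) : E →L[ℝ] E := ContinuousLinearMap.adjoint J * J

theorem inner_gram (J : E →L[ℝ] E) (x y : E) : ⟪x, gram J y⟫ = ⟪J x, J y⟫ :=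
  ContinuousLinearMap.adjoint_inner_right J x (J y)

theorem gram_isSymmetric (J : E →L[ℝ] E) : (gram J : E →ₗ[ℝ] E).IsSymmetric := fun x y => by
  change ⟪gram J x, y⟫ = ⟪x, gram J y⟫
  rw [real_inner_comm, inner_gram, inner_gram, real_inner_comm]

/-- An orthonormal basis of eigenvectors of `J* J`. -/
def eigBasis (J : E →L[ℝ] E) : OrthonormalBasis (Fin (Module.finrank ℝ E)) ℝ E :=
  (gram_isSymmetric J).eigenvectorBasis rfl

/-- The eigenvalues of `J* J`. -/
def eig (J : E →L[ℝ] E) (i : Fin (Module.finrank ℝ E)) : ℝ :=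
  (gram_isSymmetric J).eigenvalues rfl i

theorem gram_eigBasis (J : E →L[ℝ] E) (i) : gram J (eigBasis J i) = eig J i • eigBasis J i :=
  (gram_isSymmetric J).apply_eigenvectorBasis rfl i

theorem eig_eq (J : E →L[ℝ] E) (i) : eig J i = ‖J (eigBasis J i)‖ ^ 2 := by
  rw [← real_inner_self_eq_norm_sq, ← inner_gram, gram_eigBasis, inner_smul_right,
    real_inner_self_eq_norm_sq, (eigBasis J).norm_eq_one]
  simp

theorem eig_nonneg (J : E →L[ℝ] E) (i) : 0 ≤ eig J i := by rw [eig_eq]; positivity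

theorem eig_le (J : E →L[ℝ] E) (i) : eig J i ≤ ‖J‖ ^ 2 := by
  rw [eig_eq]
  have := J.le_opNorm (eigBasis J i)
  rw [(eigBasis J).norm_eq_one, mul_one] at this
  gcongr

theorem inner_eigBasis_gram (J : E →L[ℝ] E) (i) (x : E) :
    ⟪eigBasis J i, gram J x⟫ = eig J i * ⟪eigBasis J i, x⟫ := by
  rw [inner_gram, real_inner_comm, ← inner_gram, gram_eigBasis, inner_smul_right, real_inner_comm]

/-- The quadratic form `⟪x, |J| x⟫`. -/
def absForm (J : E →L[ℝ] E) (x : E) : ℝ := ∑ i, √(eig J i) * ⟪eigBasis J i, x⟫ ^ 2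

theorem aeval_gram_eigBasis (J : E →L[ℝ] E) (p : Polynomial ℝ) (i) :
    Polynomial.aeval (gram J) p (eigBasis J i) = p.eval (eig J i) • eigBasis J i := by
  induction p using Polynomial.induction_on with
  | C a => simp [Algebra.algebraMap_eq_smul_one]
  | add p q hp hq => simp [hp, hq, add_smul]
  | monomial n a h =>
    rw [pow_succ, ← mul_assoc, map_mul, Polynomial.aeval_X, mul_apply_eq_comp, gram_eigBasis,
      map_smul, h, smul_smul, mul_comm, Polynomial.eval_mul_X]

theorem inner_aeval_gram (J : E →L[ℝ] E) (p : Polynomial ℝ) (x : E) :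
    ⟪x, Polynomial.aeval (gram J) p x⟫ = ∑ i, p.eval (eig J i) * ⟪eigBasis J i, x⟫ ^ 2 := by
  have h : Polynomial.aeval (gram J) p x =
      Polynomial.aeval (gram J) p (∑ i, ⟪eigBasis J i, x⟫ • eigBasis J i) := by
    rw [(eigBasis J).sum_repr' x]
  rw [h, map_sum, inner_sum]
  refine Finset.sum_congr rfl fun i _ => ?_
  rw [map_smul, aeval_gram_eigBasis, inner_smul_right, inner_smul_right, real_inner_comm]
  ring

theorem sum_inner_eigBasis_sq (J : E →L[ℝ] E) (x : E) :
    ∑ i, ⟪eigBasis J i, x⟫ ^ 2 = ‖x‖ ^ 2 := by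
  rw [← (eigBasis J).sum_sq_norm_inner_right x]
  simp

theorem continuous_absForm : Continuous fun z : (E →L[ℝ] E) × E => absForm z.1 z.2 := by
  refine continuous_of_locally_uniform_approx_of_continuousAt fun z₀ u hu => ?_
  obtain ⟨ε, hε, hεu⟩ := Metric.mem_uniformity_dist.1 hu
  set R : ℝ := ‖z₀‖ + 1
  have hR : 0 < R := by positivity
  obtain ⟨p, hp⟩ := exists_polynomial_near_of_continuousOn 0 (R ^ 2) (fun t => √t)
    Real.continuous_sqrt.continuousOn (ε / (2 * R ^ 2)) (by positivity)
  refine ⟨{z | ‖z‖ < R}, (isOpen_lt continuous_norm continuous_const).mem_nhds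
    (by simp [R]), fun z => ⟪z.2, Polynomial.aeval (gram z.1) p z.2⟫, ?_, fun z hz => hεu ?_⟩
  · have h1 : Continuous fun z : (E →L[ℝ] E) × E => gram z.1 :=
      ((ContinuousLinearMap.adjoint (𝕜 := ℝ) (E := E) (F := E)).continuous.comp
        continuous_fst).mul continuous_fst
    have h2 : Continuous fun z : (E →L[ℝ] E) × E => Polynomial.aeval (gram z.1) p :=
      (Polynomial.continuous_aeval p).comp h1
    exact (continuous_snd.inner (h2.clm_apply continuous_snd)).continuousAt
  · have hz1 : ‖z.1‖ ≤ R := (norm_fst_le z).trans (le_of_lt hz)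
    have hz2 : ‖z.2‖ ≤ R := (norm_snd_le z).trans (le_of_lt hz)
    simp only [inner_aeval_gram]
    rw [absForm, Real.dist_eq, ← Finset.sum_sub_distrib]
    calc |∑ i, (√(eig z.1 i) * ⟪eigBasis z.1 i, z.2⟫ ^ 2 -
          p.eval (eig z.1 i) * ⟪eigBasis z.1 i, z.2⟫ ^ 2)|
        ≤ ∑ i, ε / (2 * R ^ 2) * ⟪eigBasis z.1 i, z.2⟫ ^ 2 := by
          refine (Finset.abs_sum_le_sum_abs _ _).trans (Finset.sum_le_sum fun i _ => ?_)
          rw [← sub_mul, abs_mul, abs_of_nonneg (sq_nonneg ⟪eigBasis z.1 i, z.2⟫), abs_sub_comm]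
          refine mul_le_mul_of_nonneg_right (hp _ ⟨eig_nonneg _ _, ?_⟩).le (sq_nonneg _)
          exact (eig_le _ _).trans (by gcongr)
      _ = ε / (2 * R ^ 2) * ‖z.2‖ ^ 2 := by
          rw [← Finset.mul_sum, sum_inner_eigBasis_sq]
      _ ≤ ε / (2 * R ^ 2) * R ^ 2 := by gcongr
      _ = ε / 2 := by field_simp
      _ < ε := by linarith

theorem continuous_absForm_comp {X : Type*} [TopologicalSpace X] {J : X → E →L[ℝ] E} {v : X → E}
    (hJ : Continuous J) (hv : Continuous v) : Continuous fun a => absForm (J a) (v a) := by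
  have h1 : Continuous fun a => (J a, v a) := hJ.prodMk hv
  have h2 := Continuous.comp continuous_absForm h1
  exact h2

/-- Coordinates in which a skew-symmetric operator becomes orthogonal and its absolute value
becomes the Euclidean norm. -/
theorem exists_symplectic_coordinates (J : E →L[ℝ] E) (hJ : ∀ x y, ⟪x, J y⟫ = -⟪y, J x⟫) :
    ∃ (n : ℕ) (T : EuclideanSpace ℝ (Fin n) →ₗ[ℝ] E)
      (I : EuclideanSpace ℝ (Fin n) →ₗ[ℝ] EuclideanSpace ℝ (Fin n)),
      (∀ s t, ⟪T s, J (T t)⟫ = ⟪s, I t⟫) ∧ (∀ t, ‖I t‖ = ‖t‖) ∧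
      (∀ s x, J x = 0 → absForm J (T s + x) = ‖s‖ ^ 2) ∧
      ∀ y, ∃ s x, J x = 0 ∧ y = T s + x := by
  set b := eigBasis J
  have hadj : ContinuousLinearMap.adjoint J = -J := by
    refine ((ContinuousLinearMap.eq_adjoint_iff _ _).2 fun x y => ?_).symm
    rw [neg_apply, inner_neg_left, real_inner_comm, hJ y x, neg_neg]
  have hker : ∀ x, J x = 0 → ∀ i, eig J i ≠ 0 → ⟪b i, x⟫ = 0 := by
    intro x hx i hi
    have h1 := inner_eigBasis_gram J i x
    rw [inner_gram, hx, inner_zero_right] at h1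
    exact (mul_eq_zero.1 h1.symm).resolve_left hi
  have hker' : ∀ x, (∀ i, eig J i ≠ 0 → ⟪b i, x⟫ = 0) → J x = 0 := by
    intro x hx
    have h1 : ⟪x, gram J x⟫ = 0 := by
      rw [← b.sum_inner_mul_inner]
      refine Finset.sum_eq_zero fun i _ => ?_
      rw [inner_eigBasis_gram]
      by_cases hi : eig J i = 0
      · simp [hi]
      · rw [show ⟪eigBasis J i, x⟫ = 0 from hx i hi]; simp
    rw [inner_gram] at h1
    exact inner_self_eq_zero.1 h1
  let ι := {i // eig J i ≠ 0}
  let n := Fintype.card ι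
  let f : Fin n ≃ ι := (Fintype.equivFin ι).symm
  let c : Fin n → E := fun k => b (f k).1
  let μ : Fin n → ℝ := fun k => √√(eig J (f k).1)
  have hμ : ∀ k, 0 < μ k := fun k =>
    Real.sqrt_pos.2 (Real.sqrt_pos.2 (lt_of_le_of_ne (eig_nonneg _ _) (f k).2.symm))
  have hμ2 : ∀ k, μ k ^ 2 = √(eig J (f k).1) := fun k => Real.sq_sqrt (Real.sqrt_nonneg _)
  have hμ4 : ∀ k, μ k ^ 4 = eig J (f k).1 := fun k => by
    rw [show μ k ^ 4 = (μ k ^ 2) ^ 2 by ring, hμ2, Real.sq_sqrt (eig_nonneg _ _)]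
  have hc : ∀ k l, ⟪c k, c l⟫ = if k = l then 1 else 0 := fun k l => by
    rw [orthonormal_iff_ite.1 b.orthonormal]
    simp [Subtype.val_inj]
  let ε := EuclideanSpace.basisFun (Fin n) ℝ
  let T : EuclideanSpace ℝ (Fin n) →ₗ[ℝ] E := ε.toBasis.constr ℝ fun k => (μ k)⁻¹ • c k
  have hTε : ∀ k, T (ε k) = (μ k)⁻¹ • c k := fun k => by
    rw [← ε.coe_toBasis]; exact Module.Basis.constr_basis _ _ _ _
  have hTs : ∀ s : EuclideanSpace ℝ (Fin n), T s = ∑ k, (s k * (μ k)⁻¹) • c k := fun s => by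
    conv_lhs => rw [← ε.sum_repr s]
    rw [map_sum]
    refine Finset.sum_congr rfl fun k _ => ?_
    rw [map_smul, hTε, smul_smul]
    rfl
  have hcT : ∀ k s, ⟪c k, T s⟫ = s k * (μ k)⁻¹ := fun k s => by
    rw [hTs, inner_sum, Finset.sum_eq_single k]
    · rw [inner_smul_right, hc, if_pos rfl, mul_one]
    · intro l _ hl
      rw [inner_smul_right, hc, if_neg hl.symm, mul_zero]
    · simp
  have hadjT : ∀ y k, T.adjoint y k = (μ k)⁻¹ * ⟪c k, y⟫ := fun y k => by
    have h1 : T.adjoint y k = ⟪ε k, T.adjoint y⟫ := ε.repr_apply_apply _ k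
    rw [h1, LinearMap.adjoint_inner_right, hTε, real_inner_smul_left]
  let I := T.adjoint ∘ₗ (J : E →ₗ[ℝ] E) ∘ₗ T
  have hTI : ∀ s t, ⟪T s, J (T t)⟫ = ⟪s, I t⟫ := fun s t =>
    (LinearMap.adjoint_inner_right T s (J (T t))).symm
  have hTT : ∀ k y, gram J y = eig J (f k).1 • y → T (T.adjoint y) = (μ k ^ 2)⁻¹ • y := by
    intro k y hy
    have h1 : ∀ i, eig J i ≠ eig J (f k).1 → ⟪b i, y⟫ = 0 := by
      intro i hi
      have h2 := inner_eigBasis_gram J i y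
      rw [hy, inner_smul_right] at h2
      have h3 : (eig J (f k).1 - eig J i) * ⟪b i, y⟫ = 0 := by
        rw [sub_mul, sub_eq_zero]; exact h2
      exact (mul_eq_zero.1 h3).resolve_left (sub_ne_zero.2 hi.symm)
    refine InnerProductSpace.ext_inner_left_basis b.toBasis fun i => ?_
    rw [inner_smul_right, b.coe_toBasis]
    by_cases hi : eig J i = 0
    · rw [h1 i (by rw [hi]; exact (f k).2.symm), mul_zero, hTs, inner_sum]
      refine Finset.sum_eq_zero fun l _ => ?_
      rw [inner_smul_right, orthonormal_iff_ite.1 b.orthonormal, if_neg, mul_zero]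
      rintro rfl
      exact (f l).2 hi
    · obtain ⟨l, hl⟩ := f.surjective ⟨i, hi⟩
      have hl' : b i = c l := by simp only [c, hl]
      rw [hl', hcT, hadjT]
      by_cases h : eig J i = eig J (f k).1
      · have : μ l = μ k := by simp only [μ, hl, h]
        rw [this]
        have := (hμ k).ne'
        field_simp
      · rw [← hl', h1 i h]; simp
  have hII : ∀ t, I.adjoint (I t) = t := by
    intro t
    have h1 : I.adjoint ∘ₗ I = LinearMap.id := by
      refine ε.toBasis.ext fun k => ?_
      rw [ε.coe_toBasis, LinearMap.comp_apply, LinearMap.id_apply]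
      refine ext_inner_left ℝ fun s => ?_
      rw [LinearMap.adjoint_inner_right]
      have e1 : I (ε k) = (μ k)⁻¹ • T.adjoint (J (c k)) := by
        change T.adjoint (J (T (ε k))) = _
        rw [hTε, map_smul, map_smul]
      have e2 : gram J (J (c k)) = eig J (f k).1 • J (c k) := by
        have h := gram_eigBasis J (f k).1
        rw [gram, hadj] at h ⊢
        rw [mul_apply_eq_comp, neg_apply] at h ⊢
        rw [← map_neg, h, map_smul]
      have e3 := hTT k _ e2
      have e4 : ⟪I s, I (ε k)⟫ = (μ k)⁻¹ * ((μ k ^ 2)⁻¹ * ⟪J (T s), J (c k)⟫) := by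
        rw [e1, inner_smul_right, LinearMap.adjoint_inner_right]
        have e5 : ⟪T (I s), J (c k)⟫ = ⟪J (T s), T (T.adjoint (J (c k)))⟫ := by
          change ⟪T (T.adjoint (J (T s))), J (c k)⟫ = _
          rw [← LinearMap.adjoint_inner_right, LinearMap.adjoint_inner_left]
        rw [e5, e3, inner_smul_right]
      rw [e4, ← inner_gram, gram_eigBasis, inner_smul_right, real_inner_comm]
      have e6 : ⟪b (f k).1, T s⟫ = s k * (μ k)⁻¹ := hcT k s
      rw [e6, ← hμ4]
      have e7 : ⟪s, ε k⟫ = s k := by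
        rw [real_inner_comm]; exact (ε.repr_apply_apply s k).symm
      rw [e7]
      have := (hμ k).ne'
      field_simp
    exact congrArg (fun L : EuclideanSpace ℝ (Fin n) →ₗ[ℝ] EuclideanSpace ℝ (Fin n) => L t) h1
  refine ⟨n, T, I, hTI, fun t => ?_, fun s x hx => ?_, fun y => ?_⟩
  · have h1 : ⟪I t, I t⟫ = ⟪t, t⟫ := by rw [← LinearMap.adjoint_inner_right, hII]
    rw [real_inner_self_eq_norm_sq, real_inner_self_eq_norm_sq] at h1
    exact (sq_eq_sq₀ (norm_nonneg _) (norm_nonneg _)).1 h1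
  · have h1 : absForm J (T s + x) = ∑ i : ι, √(eig J i.1) * ⟪b i.1, T s + x⟫ ^ 2 := by
      rw [absForm, ← Finset.sum_filter_of_ne (p := fun i => eig J i ≠ 0)]
      · exact Finset.sum_subtype _ (by simp) _
      · intro i _ hi h
        rw [h] at hi
        simp at hi
    rw [h1, ← f.sum_comp, EuclideanSpace.real_norm_sq_eq]
    refine Finset.sum_congr rfl fun k _ => ?_
    rw [inner_add_right, hker x hx _ (f k).2, add_zero, ← hμ2]
    have e6 : ⟪b (f k).1, T s⟫ = s k * (μ k)⁻¹ := hcT k s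
    rw [e6]
    have := (hμ k).ne'
    field_simp
  · refine ⟨WithLp.toLp 2 fun k => μ k * ⟪c k, y⟫, y - T (WithLp.toLp 2 fun k => μ k * ⟪c k, y⟫),
      hker' _ fun i hi => ?_, by abel⟩
    obtain ⟨l, hl⟩ := f.surjective ⟨i, hi⟩
    have hl' : b i = c l := by simp only [c, hl]
    rw [hl', inner_sub_right, hcT]
    have := (hμ l).ne'
    simp only
    field_simp
    simp

end AbsForm

end TwoStep

end

noncomputable section

namespace TwoStep

open Grp

/-! ### Coadjoint orbits -/

section Coadjoint

variable {𝔤 : Type*} [LieRing 𝔤] [LieAlgebra ℝ 𝔤]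

theorem tendsto_dual_iff {ι : Type*} {f : ι → Module.Dual ℝ 𝔤} {l : Filter ι}
    {m : Module.Dual ℝ 𝔤} :
    Tendsto f l (𝓝 m) ↔ ∀ x, Tendsto (fun i => f i x) l (𝓝 (m x)) := by
  rw [nhds_induced, tendsto_comap_iff, tendsto_pi_nhds]
  rfl

theorem continuous_dual_eval (x : 𝔤) : Continuous fun m : Module.Dual ℝ 𝔤 => m x :=
  (continuous_apply x).comp continuous_induced_dom

theorem continuous_dual_rng {X : Type*} [TopologicalSpace X] {f : X → Module.Dual ℝ 𝔤}
    (h : ∀ x, Continuous fun a => f a x) : Continuous f :=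
  continuous_induced_rng.2 (continuous_pi h)

theorem continuous_dual_apply [FiniteDimensional ℝ 𝔤] [TopologicalSpace 𝔤]
    [IsTopologicalAddGroup 𝔤] [ContinuousSMul ℝ 𝔤] [T2Space 𝔤] :
    Continuous fun z : Module.Dual ℝ 𝔤 × 𝔤 => z.1 z.2 := by
  let b := Module.finBasis ℝ 𝔤
  have h : (fun z : Module.Dual ℝ 𝔤 × 𝔤 => z.1 z.2) =
      fun z => ∑ i, b.coord i z.2 * z.1 (b i) := by
    funext z
    conv_lhs => rw [← b.sum_repr z.2]
    simp only [map_sum, map_smul, smul_eq_mul, Module.Basis.coord_apply]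
  rw [h]
  refine continuous_finsetSum _ fun i _ => Continuous.mul ?_ ?_
  · exact (LinearMap.continuous_of_finiteDimensional (b.coord i)).comp continuous_snd
  · exact (continuous_dual_eval (b i)).comp continuous_fst

theorem lie_mem_radical [IsTwoStep 𝔤] (ℓ : Module.Dual ℝ 𝔤) (x y : 𝔤) : ⁅x, y⁆ ∈ radical ℓ :=
  fun z => by rw [lie_lie_left, map_zero]

theorem coadjoint_apply [IsTwoStep 𝔤] (x : Grp 𝔤) (ℓ : Module.Dual ℝ 𝔤) (y : 𝔤) :
    (x • ℓ) y = ℓ y - ℓ ⁅log x, y⁆ := by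
  change ℓ (Ad x⁻¹ y) = _
  rw [Ad_apply, ← map_sub]
  congr 1
  simp only [log_mul, log_exp, log_inv, inv_inv, lie_add, add_lie, lie_smul, smul_lie, lie_lie_left,
    IsTwoStep.lie_lie_eq_zero, neg_lie, lie_neg, lie_self, smul_neg, smul_zero, neg_zero, add_zero,
    zero_add]
  rw [← lie_skew y (log x)]
  module

theorem range_bracketForm [FiniteDimensional ℝ 𝔤] (ℓ : Module.Dual ℝ 𝔤) :
    LinearMap.range (bracketForm ℓ) = (radical ℓ).dualAnnihilator := by
  refine Submodule.eq_of_le_of_finrank_eq ?_ ?_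
  · rintro _ ⟨x, rfl⟩
    rw [Submodule.mem_dualAnnihilator]
    intro y hy
    rw [bracketForm_apply, ← lie_skew, map_neg, hy x, neg_zero]
  · have h1 := (bracketForm ℓ).finrank_range_add_finrank_ker
    have h2 := Subspace.finrank_add_finrank_dualAnnihilator_eq (radical ℓ)
    have h3 : LinearMap.ker (bracketForm ℓ) = radical ℓ := by
      ext x
      rw [LinearMap.mem_ker]
      exact ⟨fun h y => by rw [← bracketForm_apply, h, LinearMap.zero_apply],
        fun h => LinearMap.ext fun y => h y⟩
    rw [h3, add_comm] at h1
    exact Nat.add_left_cancel (h1.trans h2.symm)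

variable [IsTwoStep 𝔤] [FiniteDimensional ℝ 𝔤]

theorem mem_orbit_iff {ℓ m : Module.Dual ℝ 𝔤} :
    m ∈ MulAction.orbit (Grp 𝔤) ℓ ↔ m - ℓ ∈ (radical ℓ).dualAnnihilator := by
  rw [← range_bracketForm]
  constructor
  · rintro ⟨x, rfl⟩
    refine ⟨-log x, LinearMap.ext fun y => ?_⟩
    rw [bracketForm_apply, LinearMap.sub_apply, coadjoint_apply, neg_lie, map_neg]
    ring
  · rintro ⟨x, hx⟩
    refine ⟨exp (-x), LinearMap.ext fun y => ?_⟩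
    have h := congrArg (fun L : Module.Dual ℝ 𝔤 => L y) hx
    simp only [bracketForm_apply, LinearMap.sub_apply] at h
    change (exp (-x) • ℓ) y = m y
    rw [coadjoint_apply, log_exp, neg_lie, map_neg, h]
    ring

theorem orbitOf_orbit (ℓ : Module.Dual ℝ 𝔤) :
    (orbitOf ℓ).orbit = MulAction.orbit (Grp 𝔤) ℓ :=
  MulAction.orbitRel.Quotient.orbit_mk ℓ

theorem mem_orbitOf_iff {ℓ m : Module.Dual ℝ 𝔤} :
    m ∈ (orbitOf ℓ).orbit ↔ m - ℓ ∈ (radical ℓ).dualAnnihilator := by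
  rw [orbitOf_orbit, mem_orbit_iff]

theorem mem_orbit_iff_orbitOf {O : OrbitSpace 𝔤} {m : Module.Dual ℝ 𝔤} :
    m ∈ O.orbit ↔ orbitOf m = O :=
  MulAction.orbitRel.Quotient.mem_orbit

theorem radical_eq_of_lie_eq {ℓ m : Module.Dual ℝ 𝔤} (h : ∀ x y : 𝔤, m ⁅x, y⁆ = ℓ ⁅x, y⁆) :
    radical m = radical ℓ := by
  ext x
  exact ⟨fun hx y => by rw [← h]; exact hx y, fun hx y => by rw [h]; exact hx y⟩

theorem lie_eq_of_sub_mem {ℓ m : Module.Dual ℝ 𝔤} {u : Submodule ℝ 𝔤}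
    (hu : ∀ x y : 𝔤, ⁅x, y⁆ ∈ u) (h : m - ℓ ∈ u.dualAnnihilator) (x y : 𝔤) :
    m ⁅x, y⁆ = ℓ ⁅x, y⁆ :=
  sub_eq_zero.1 ((Submodule.mem_dualAnnihilator _).1 h _ (hu x y))

theorem radical_eq_of_mem {O : OrbitSpace 𝔤} {ℓ m : Module.Dual ℝ 𝔤} (hℓ : ℓ ∈ O.orbit)
    (hm : m ∈ O.orbit) : radical m = radical ℓ := by
  rw [mem_orbit_iff_orbitOf] at hℓ
  rw [← hℓ, mem_orbitOf_iff] at hm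
  exact radical_eq_of_lie_eq (lie_eq_of_sub_mem (lie_mem_radical ℓ) hm)

theorem eq_on_radical_of_mem {O : OrbitSpace 𝔤} {ℓ m : Module.Dual ℝ 𝔤} (hℓ : ℓ ∈ O.orbit)
    (hm : m ∈ O.orbit) {x : 𝔤} (hx : x ∈ radical ℓ) : m x = ℓ x := by
  rw [mem_orbit_iff_orbitOf] at hℓ
  rw [← hℓ, mem_orbitOf_iff] at hm
  exact sub_eq_zero.1 ((Submodule.mem_dualAnnihilator _).1 hm _ hx)

theorem orbitOf_orbit_eq_image (ℓ : Module.Dual ℝ 𝔤) : (orbitOf ℓ).orbit =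
    (fun q => ℓ + q) '' ((radical ℓ).dualAnnihilator : Set (Module.Dual ℝ 𝔤)) := by
  ext m
  rw [mem_orbitOf_iff]
  constructor
  · exact fun h => ⟨m - ℓ, h, by simp⟩
  · rintro ⟨q, hq, rfl⟩
    simpa using hq

theorem orbitDim_add_finrank_radical {O : OrbitSpace 𝔤} {ℓ : Module.Dual ℝ 𝔤}
    (hℓ : ℓ ∈ O.orbit) :
    orbitDim O + Module.finrank ℝ (radical ℓ) = Module.finrank ℝ 𝔤 := by
  rw [mem_orbit_iff_orbitOf] at hℓ
  subst hℓ
  have h : vectorSpan ℝ (orbitOf ℓ).orbit = (radical ℓ).dualAnnihilator := by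
    have h1 : (orbitOf ℓ).orbit = (AffineSubspace.mk' ℓ (radical ℓ).dualAnnihilator :
        Set (Module.Dual ℝ 𝔤)) := by
      ext m
      rw [mem_orbitOf_iff]
      exact (AffineSubspace.mem_mk' (k := ℝ) (p := ℓ) (q := m)).symm
    rw [h1, ← AffineSubspace.direction_eq_vectorSpan, AffineSubspace.direction_mk']
  rw [orbitDim, h, add_comm]
  exact Subspace.finrank_add_finrank_dualAnnihilator_eq _

/-- Convergence of orbits is convergence of suitable representatives. -/
theorem tendsto_orbit_iff {O : ℕ → OrbitSpace 𝔤} {m : Module.Dual ℝ 𝔤} :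
    Tendsto O atTop (𝓝 (orbitOf m)) ↔
      ∃ ms : ℕ → Module.Dual ℝ 𝔤, (∀ k, ms k ∈ (O k).orbit) ∧ Tendsto ms atTop (𝓝 m) := by
  constructor
  · intro h
    let b := Module.finBasis ℝ 𝔤
    let N : Module.Dual ℝ 𝔤 → ℝ := fun m' => ∑ i, |m' (b i) - m (b i)|
    have hNc : Continuous N := continuous_finsetSum _ fun i _ =>
      ((continuous_dual_eval (b i)).sub continuous_const).abs
    have hN0 : ∀ m', 0 ≤ N m' := fun m' => Finset.sum_nonneg fun i _ => abs_nonneg _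
    have hne : ∀ k, (N '' (O k).orbit).Nonempty := fun k => by
      obtain ⟨m', hm'⟩ := Quotient.exists_rep (O k)
      exact ⟨_, m', mem_orbit_iff_orbitOf.2 hm', rfl⟩
    have hbdd : ∀ k, BddBelow (N '' (O k).orbit) := fun k =>
      ⟨0, by rintro _ ⟨m', _, rfl⟩; exact hN0 m'⟩
    have hex : ∀ k : ℕ, ∃ m' ∈ (O k).orbit, N m' < sInf (N '' (O k).orbit) + 1 / (k + 1 : ℝ) := by
      intro k
      obtain ⟨_, ⟨m', hm', rfl⟩, h1⟩ := exists_lt_of_csInf_lt (hne k)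
        (lt_add_of_pos_right _ (Nat.one_div_pos_of_nat (n := k) (α := ℝ)))
      exact ⟨m', hm', h1⟩
    choose ms hms hlt using hex
    refine ⟨ms, hms, ?_⟩
    have hN : Tendsto (fun k => N (ms k)) atTop (𝓝 0) := by
      rw [tendsto_order]
      refine ⟨fun a ha => Eventually.of_forall fun k => ha.trans_le (hN0 _), fun a ha => ?_⟩
      have hopen : IsOpen (Quotient.mk _ '' {m' | N m' < a / 2} : Set (OrbitSpace 𝔤)) := by
        have hcont : ∀ x : Grp 𝔤, Continuous fun m : Module.Dual ℝ 𝔤 => x • m := fun x => by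
          refine continuous_dual_rng fun y => ?_
          simp only [coadjoint_apply]
          exact (continuous_dual_eval _).sub (continuous_dual_eval _)
        have : ContinuousConstSMul (Grp 𝔤) (Module.Dual ℝ 𝔤) := ⟨hcont⟩
        exact isOpenMap_quotient_mk'_mul _ (isOpen_lt hNc continuous_const)
      have hmem : orbitOf m ∈ (Quotient.mk _ '' {m' | N m' < a / 2} : Set (OrbitSpace 𝔤)) :=
        ⟨m, by simpa [N] using ha, rfl⟩
      filter_upwards [h (hopen.mem_nhds hmem),
        tendsto_one_div_add_atTop_nhds_zero_nat.eventually_lt_const (half_pos ha)] with k hk hk2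
      obtain ⟨m', hm', hO⟩ := hk
      have h1 : sInf (N '' (O k).orbit) ≤ N m' :=
        csInf_le (hbdd k) ⟨m', mem_orbit_iff_orbitOf.2 hO, rfl⟩
      have h2 : N m' < a / 2 := hm'
      linarith [hlt k]
    rw [tendsto_dual_iff]
    intro x
    have hb : ∀ i, Tendsto (fun k => ms k (b i)) atTop (𝓝 (m (b i))) := by
      intro i
      rw [tendsto_iff_norm_sub_tendsto_zero]
      exact squeeze_zero (fun k => norm_nonneg _) (fun k =>
        Finset.single_le_sum (f := fun i => |ms k (b i) - m (b i)|)
          (fun i _ => abs_nonneg _) (Finset.mem_univ i)) hN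
    have hx : ∀ m' : Module.Dual ℝ 𝔤, m' x = ∑ i, b.repr x i * m' (b i) := fun m' => by
      conv_lhs => rw [← b.sum_repr x]
      simp only [map_sum, map_smul, smul_eq_mul]
    simp only [hx]
    exact tendsto_finsetSum _ fun i _ => (hb i).const_mul _
  · rintro ⟨ms, hms, h⟩
    have hc : Continuous (orbitOf : Module.Dual ℝ 𝔤 → OrbitSpace 𝔤) := continuous_quotient_mk'
    have := (hc.tendsto m).comp h
    refine this.congr fun k => ?_
    exact mem_orbit_iff_orbitOf.1 (hms k)

theorem mem_orbitUnion_limitSet {O : ℕ → OrbitSpace 𝔤} {m : Module.Dual ℝ 𝔤} :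
    m ∈ orbitUnion (limitSet O) ↔
      ∃ ms : ℕ → Module.Dual ℝ 𝔤, (∀ k, ms k ∈ (O k).orbit) ∧ Tendsto ms atTop (𝓝 m) := by
  rw [← tendsto_orbit_iff, orbitUnion, Set.mem_iUnion₂]
  constructor
  · rintro ⟨O', hO', hm⟩
    rw [mem_orbit_iff_orbitOf] at hm
    rw [hm]
    exact hO'
  · exact fun h => ⟨orbitOf m, h, mem_orbit_iff_orbitOf.2 rfl⟩

end Coadjoint

end TwoStep

end

noncomputable section

namespace TwoStep

open Grp

/-! ### Gaussian coefficients of representations -/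

section GaussianCoefficient

open RealInnerProductSpace

variable {𝔤 : Type*} [LieRing 𝔤] [LieAlgebra ℝ 𝔤] [FiniteDimensional ℝ 𝔤]
  [TopologicalSpace 𝔤] [IsTopologicalAddGroup 𝔤] [ContinuousSMul ℝ 𝔤] [T2Space 𝔤]

/-- The operator representing the form `B_m` in Euclidean coordinates. -/
def formOp (m : Module.Dual ℝ 𝔤) : EuclideanSpace ℝ (Fin (Module.finrank ℝ 𝔤)) →L[ℝ]
    EuclideanSpace ℝ (Fin (Module.finrank ℝ 𝔤)) :=
  ∑ i, ∑ j, m ⁅(toEuclidean (E := 𝔤)).symm (EuclideanSpace.basisFun _ ℝ i),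
      (toEuclidean (E := 𝔤)).symm (EuclideanSpace.basisFun _ ℝ j)⁆ •
    (innerSL ℝ (EuclideanSpace.basisFun _ ℝ j)).smulRight (EuclideanSpace.basisFun _ ℝ i)

theorem inner_formOp (m : Module.Dual ℝ 𝔤) (x y : 𝔤) :
    ⟪toEuclidean x, formOp m (toEuclidean y)⟫ = m ⁅x, y⁆ := by
  set b := EuclideanSpace.basisFun (Fin (Module.finrank ℝ 𝔤)) ℝ
  have h : ∀ z : 𝔤, z = ∑ i, ⟪b i, toEuclidean z⟫ • (toEuclidean (E := 𝔤)).symm (b i) := fun z => by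
    apply (toEuclidean (E := 𝔤)).injective
    rw [map_sum]
    simp only [map_smul, ContinuousLinearEquiv.apply_symm_apply]
    exact (b.sum_repr' _).symm
  have h1 : m ⁅x, y⁆ = ∑ i, ∑ j, ⟪b i, toEuclidean x⟫ * (⟪b j, toEuclidean y⟫ *
      m ⁅(toEuclidean (E := 𝔤)).symm (b i), (toEuclidean (E := 𝔤)).symm (b j)⁆) := by
    rw [← bracketForm_apply]
    conv_lhs => rw [h x, h y]
    simp only [map_sum, LinearMap.sum_apply, map_smul, LinearMap.smul_apply, smul_eq_mul,
      bracketForm_apply, Finset.mul_sum]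
    rw [Finset.sum_comm]
    refine Finset.sum_congr rfl fun i _ => Finset.sum_congr rfl fun j _ => by ring
  rw [h1]
  simp only [formOp, sum_apply, inner_sum, smul_apply,
    ContinuousLinearMap.smulRight_apply, inner_smul_right, innerSL_apply_apply]
  refine Finset.sum_congr rfl fun i _ => Finset.sum_congr rfl fun j _ => ?_
  rw [real_inner_comm (b i)]
  ring

theorem continuous_formOp : Continuous (formOp : Module.Dual ℝ 𝔤 → _) := by
  unfold formOp
  exact continuous_finsetSum _ fun i _ => continuous_finsetSum _ fun j _ =>
    (continuous_dual_eval _).smul continuous_const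

/-- The coefficient `χ_m(x) exp(-π ⟪x, |B_m| x⟫ / 2)`. -/
def gaussCoeff (m : Module.Dual ℝ 𝔤) (x : Grp 𝔤) : ℂ :=
  (Real.fourierChar (-m (log x)) : ℂ) *
    (Real.exp (-(Real.pi / 2) * absForm (formOp m) (toEuclidean (log x))) : ℂ)

variable [IsTwoStep 𝔤]

theorem continuous_gaussCoeff :
    Continuous fun z : Module.Dual ℝ 𝔤 × Grp 𝔤 => gaussCoeff z.1 z.2 := by
  have h0 : Continuous fun z : Module.Dual ℝ 𝔤 × Grp 𝔤 => (log z.2 : 𝔤) :=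
    (continuous_log (𝔤 := 𝔤)).comp continuous_snd
  have h1 : Continuous fun z : Module.Dual ℝ 𝔤 × Grp 𝔤 => z.1 (log z.2) :=
    continuous_dual_apply.comp (continuous_fst.prodMk h0)
  have h2 : Continuous fun z : Module.Dual ℝ 𝔤 × Grp 𝔤 =>
      absForm (formOp z.1) (toEuclidean (log z.2)) := by
    have h3 : Continuous fun z : Module.Dual ℝ 𝔤 × Grp 𝔤 => toEuclidean (log z.2) :=
      (toEuclidean (E := 𝔤)).continuous.comp h0
    have h4 : Continuous fun z : Module.Dual ℝ 𝔤 × Grp 𝔤 => formOp z.1 :=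
      continuous_formOp.comp continuous_fst
    exact continuous_absForm_comp h4 h3
  exact (continuous_subtype_val.comp (Real.continuous_fourierChar.comp h1.neg)).mul
    (Complex.continuous_ofReal.comp (Real.continuous_exp.comp (continuous_const.mul h2)))

/-- The group `exp 𝔤(m)` acts by the character `χ_m`. -/
def ActsBy (ρ : UnitaryRep (Grp 𝔤)) (m : Module.Dual ℝ 𝔤) : Prop :=
  ∀ x ∈ radical m, ∀ ξ : ρ.H, ρ.ρ (exp x) ξ = (Real.fourierChar (-m x) : ℂ) • ξ

/-- The product of a unitary operator with a complex number of modulus one. -/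
def circleSmul {H : Type*} [NormedAddCommGroup H] [InnerProductSpace ℂ H] (z : Circle)
    (U : H ≃ₗᵢ[ℂ] H) : H ≃ₗᵢ[ℂ] H where
  toLinearEquiv := U.toLinearEquiv.trans (LinearEquiv.smulOfNeZero ℂ H (z : ℂ) (Circle.coe_ne_zero z))
  norm_map' ξ := by
    change ‖(z : ℂ) • U ξ‖ = ‖ξ‖
    rw [norm_smul, Circle.norm_coe, one_mul, LinearIsometryEquiv.norm_map]

theorem circleSmul_apply {H : Type*} [NormedAddCommGroup H] [InnerProductSpace ℂ H] (z : Circle)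
    (U : H ≃ₗᵢ[ℂ] H) (ξ : H) : circleSmul z U ξ = (z : ℂ) • U ξ := rfl

theorem ActsBy.rho_exp_add {ρ : UnitaryRep (Grp 𝔤)} {m : Module.Dual ℝ 𝔤} (h : ActsBy ρ m)
    (x : 𝔤) {y : 𝔤} (hy : y ∈ radical m) (ξ : ρ.H) :
    ρ.ρ (exp (x + y)) ξ = (Real.fourierChar (-m y) : ℂ) • ρ.ρ (exp x) ξ := by
  have h1 : (exp (x + y) : Grp 𝔤) = exp x * exp (y - (1 / 2 : ℝ) • ⁅x, y⁆) := by
    apply log_injective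
    simp only [log_mul, log_exp, lie_sub, lie_smul, IsTwoStep.lie_lie_eq_zero, smul_zero, sub_zero]
    abel
  have h2 : m ⁅x, y⁆ = 0 := by rw [← lie_skew, map_neg, hy x, neg_zero]
  rw [h1, UnitaryRep.rho_mul_apply, h _ (Submodule.sub_mem _ hy
    (Submodule.smul_mem _ _ (lie_mem_radical m x y))), map_smul, map_sub, map_smul, h2, smul_zero,
    sub_zero]

/-- A representation in which `exp 𝔤(m)` acts by `χ_m` has a unit vector with Gaussian
coefficient. -/
theorem ActsBy.exists_gaussian_vector {ρ : UnitaryRep (Grp 𝔤)} {m : Module.Dual ℝ 𝔤}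
    (h : ActsBy ρ m) [Nontrivial ρ.H] :
    ∃ ξ : ρ.H, ‖ξ‖ = 1 ∧ ∀ x, inner ℂ ξ (ρ.ρ x ξ) = gaussCoeff m x := by
  have hskew : ∀ x y, ⟪x, formOp m y⟫ = -⟪y, formOp m x⟫ := fun x y => by
    obtain ⟨x, rfl⟩ := (toEuclidean (E := 𝔤)).surjective x
    obtain ⟨y, rfl⟩ := (toEuclidean (E := 𝔤)).surjective y
    rw [inner_formOp, inner_formOp, ← lie_skew, map_neg]
  obtain ⟨n, T, I, hTI, hI, habs, hdec⟩ := exists_symplectic_coordinates (formOp m) hskew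
  let T' : EuclideanSpace ℝ (Fin n) →ₗ[ℝ] 𝔤 := (toEuclidean (E := 𝔤)).symm.toLinearMap ∘ₗ T
  have hTT' : ∀ s, toEuclidean (T' s) = T s := fun s =>
    (toEuclidean (E := 𝔤)).apply_symm_apply _
  have hform : ∀ s t, m ⁅T' s, T' t⁆ = ⟪s, I t⟫ := fun s t => by
    rw [← hTI, ← inner_formOp, hTT', hTT']
  have hrad : ∀ x, formOp m (toEuclidean x) = 0 → x ∈ radical m := fun x hx y => by
    rw [← lie_skew, map_neg, ← inner_formOp, hx, inner_zero_right, neg_zero]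
  have hT'c : Continuous T' := T'.continuous_of_finiteDimensional
  let W : EuclideanSpace ℝ (Fin n) → ρ.H ≃ₗᵢ[ℂ] ρ.H := fun s =>
    circleSmul (Real.fourierChar (m (T' s))) (ρ.ρ (exp (T' s)))
  have hW : IsWeylSystem I W :=
    { norm_map := hI
      skew := fun s t => by rw [← hform, ← hform, ← lie_skew, map_neg]
      mul := fun s t η => by
        have h1 : (exp (T' s) * exp (T' t) : Grp 𝔤) =
            exp (T' (s + t) + (1 / 2 : ℝ) • ⁅T' s, T' t⁆) := by
          rw [map_add]; rfl
        simp only [W, circleSmul_apply]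
        rw [map_smul, ← UnitaryRep.rho_mul_apply, h1, h.rho_exp_add _
          (Submodule.smul_mem _ _ (lie_mem_radical m _ _)), map_smul, hform, smul_smul, smul_smul,
          smul_smul, ← Circle.coe_mul, ← Circle.coe_mul, ← Circle.coe_mul,
          ← AddChar.map_add_eq_mul, ← AddChar.map_add_eq_mul, ← AddChar.map_add_eq_mul,
          map_add T', map_add m]
        congr 3
        simp only [smul_eq_mul]
        ring
      continuous := fun η => by
        simp only [W, circleSmul_apply]
        have hmc : Continuous m := m.continuous_of_finiteDimensional
        exact (continuous_subtype_val.comp (Real.continuous_fourierChar.comp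
          (hmc.comp hT'c))).smul ((ρ.continuous_apply η).comp (continuous_exp.comp hT'c)) }
  obtain ⟨ξ, hξ, hcoef⟩ := hW.exists_gaussian_vector
  refine ⟨ξ, hξ, fun x => ?_⟩
  obtain ⟨s, x', hx', hdec⟩ := hdec (toEuclidean (log x))
  set y := (toEuclidean (E := 𝔤)).symm x'
  have hy' : toEuclidean y = x' := (toEuclidean (E := 𝔤)).apply_symm_apply _
  have hy : y ∈ radical m := hrad _ (by rw [hy', hx'])
  have hx : x = exp (T' s + y) := by
    apply log_injective
    apply (toEuclidean (E := 𝔤)).injective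
    rw [log_exp, map_add, hTT', hy', hdec]
  have h1 := hcoef s
  simp only [W, circleSmul_apply] at h1
  rw [inner_smul_right] at h1
  have h2 : (Real.fourierChar (m (T' s)) : ℂ) * (Real.fourierChar (-m (T' s)) : ℂ) = 1 := by
    rw [← Circle.coe_mul, ← AddChar.map_add_eq_mul, add_neg_cancel, AddChar.map_zero_eq_one,
      Circle.coe_one]
  rw [gaussCoeff, hdec, habs s x' hx']
  change _ = _ * ((gaussian s : ℝ) : ℂ)
  rw [← h1, hx, h.rho_exp_add _ hy, inner_smul_right, log_exp, map_add, neg_add,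
    AddChar.map_add_eq_mul, Circle.coe_mul]
  linear_combination (-(Real.fourierChar (-m y) : ℂ) * inner ℂ ξ (ρ.ρ (exp (T' s)) ξ)) * h2

/-- Stone-von Neumann: the action of `exp 𝔤(m)` determines an irreducible representation. -/
theorem ActsBy.equivalent {ρ ρ' : UnitaryRep (Grp 𝔤)} {m : Module.Dual ℝ 𝔤} (h : ActsBy ρ m)
    (h' : ActsBy ρ' m) (hρ : ρ.IsIrreducible) (hρ' : ρ'.IsIrreducible) :
    UnitaryRep.Equivalent ρ ρ' := by
  have := hρ.1
  have := hρ'.1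
  obtain ⟨ξ, hξ, hc⟩ := h.exists_gaussian_vector
  obtain ⟨ξ', hξ', hc'⟩ := h'.exists_gaussian_vector
  exact hρ.equivalent_of_coeff_eq hρ' (norm_ne_zero_iff.1 (by simp [hξ]))
    (norm_ne_zero_iff.1 (by simp [hξ'])) fun x => (hc x).trans (hc' x).symm

end GaussianCoefficient

/-! ### Induced representations -/

section InducedRep

variable {𝔤 : Type*} [LieRing 𝔤] [LieAlgebra ℝ 𝔤] [FiniteDimensional ℝ 𝔤]
  [TopologicalSpace 𝔤] [IsTopologicalAddGroup 𝔤] [ContinuousSMul ℝ 𝔤] [T2Space 𝔤] [IsTwoStep 𝔤]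
  {ℓ : Module.Dual ℝ 𝔤} {p : LieSubalgebra ℝ 𝔤}

theorem phase_exp_inv_mul (hp : IsPolarization ℓ p) (c : Coords p) {y : 𝔤} (hy : y ∈ p)
    (r : Fin c.m → ℝ) :
    phase ℓ c ((exp y)⁻¹ * exp (c.σ r)) = -ℓ y + ℓ ⁅c.σ r, y⁆ := by
  rw [phase, τ_log_mul hp, log_inv, log_exp, log_exp, map_neg, c.τ_eq_zero.2 hy, neg_zero, zero_add,
    c.τ_σ, ← map_neg, ← map_add]
  congr 1
  simp only [log_mul, log_exp, log_inv, lie_add, add_lie, lie_smul, smul_lie, lie_lie_left,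
    IsTwoStep.lie_lie_eq_zero, neg_lie, lie_neg, lie_self, smul_neg, smul_zero, neg_zero, add_zero,
    zero_add]
  rw [← lie_skew y (c.σ r)]
  module

theorem coeFn_indOp_exp (hp : IsPolarization ℓ p) (c : Coords p) {y : 𝔤} (hy : y ∈ p)
    (φ : IndSpace c) : indOp hp c (exp y) φ =ᵐ[volume]
      fun r => (Real.fourierChar (-ℓ y + ℓ ⁅c.σ r, y⁆) : ℂ) * φ r := by
  refine (coeFn_indOp hp c (exp y) φ).trans (Eventually.of_forall fun r => ?_)
  simp only [leftTranslate_apply hp, phase_exp_inv_mul hp c hy, log_exp, c.τ_eq_zero.2 hy, sub_zero]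

theorem actsBy_inducedRep (hp : IsPolarization ℓ p) (c : Coords p) :
    ActsBy (inducedRep hp c) ℓ := by
  intro x hx φ
  change IndSpace c at φ
  refine Lp.ext ((coeFn_indOp_exp hp c (hp.radical_le hx) φ).trans ?_)
  refine EventuallyEq.trans (Eventually.of_forall fun r => ?_) (Lp.coeFn_smul _ φ).symm
  simp only [Pi.smul_apply, smul_eq_mul]
  rw [← lie_skew, map_neg, hx, neg_zero, add_zero]

theorem exists_mem_polarization (hp : IsPolarization ℓ p) (c : Coords p)
    (L : (Fin c.m → ℝ) →ₗ[ℝ] ℝ) : ∃ y ∈ p, ∀ r, ℓ ⁅c.σ r, y⁆ = L r := by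
  let Φ : p.toSubmodule →ₗ[ℝ] Module.Dual ℝ (Fin c.m → ℝ) :=
    LinearMap.mk₂ ℝ (fun y r => ℓ ⁅c.σ r, y.1⁆) (by simp) (by simp) (by simp) (by simp)
  have hΦ : ∀ y r, Φ y r = ℓ ⁅c.σ r, y.1⁆ := fun _ _ => rfl
  have hdecomp : ∀ z, z - c.σ (c.τ z) ∈ p := fun z => by
    rw [← c.τ_eq_zero, map_sub, c.τ_σ, sub_self]
  have hker : (LinearMap.ker Φ).map p.toSubmodule.subtype = radical ℓ := by
    ext y
    constructor
    · rintro ⟨y, hy, rfl⟩ z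
      have h1 : Φ y (c.τ z) = 0 := by rw [LinearMap.mem_ker.1 hy]; rfl
      rw [hΦ] at h1
      have h2 := hp.1 _ y.2 _ (hdecomp z)
      have h3 : ⁅y.1, z⁆ = ⁅y.1, z - c.σ (c.τ z)⁆ - ⁅c.σ (c.τ z), y.1⁆ := by
        rw [lie_sub, ← lie_skew (c.σ (c.τ z)) y.1]; abel
      change ℓ ⁅y.1, z⁆ = 0
      rw [h3, map_sub, h1, h2, sub_zero]
    · intro hy
      refine ⟨⟨y, hp.radical_le hy⟩, LinearMap.mem_ker.2 (LinearMap.ext fun r => ?_), rfl⟩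
      rw [hΦ, ← lie_skew, map_neg, hy, neg_zero]
      rfl
  have h1 := Φ.finrank_range_add_finrank_ker
  have h2 : Module.finrank ℝ (LinearMap.ker Φ) = Module.finrank ℝ (radical ℓ) := by
    rw [← hker]
    exact (LinearEquiv.finrank_eq (Submodule.equivMapOfInjective _
      (Submodule.injective_subtype _) _))
  have h3 := c.τ.finrank_range_add_finrank_ker
  rw [c.ker_τ, LinearMap.range_eq_top.2 fun r => ⟨c.σ r, c.τ_σ r⟩, finrank_top,
    Module.finrank_fin_fun] at h3
  have h4 := hp.2
  have h5 : Module.finrank ℝ p = Module.finrank ℝ p.toSubmodule := rfl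
  have h6 : Module.finrank ℝ (Module.Dual ℝ (Fin c.m → ℝ)) = c.m := by
    rw [Subspace.dual_finrank_eq, Module.finrank_fin_fun]
  have h7 : LinearMap.range Φ = ⊤ := Submodule.eq_top_of_finrank_eq (by omega)
  obtain ⟨y, hy⟩ : L ∈ LinearMap.range Φ := by rw [h7]; trivial
  exact ⟨y.1, y.2, fun r => by rw [← hy]; rfl⟩

theorem isIrreducible_inducedRep (hp : IsPolarization ℓ p) (c : Coords p) :
    (inducedRep hp c).IsIrreducible := by
  have hnt : Nontrivial (IndSpace c) := by
    let f := indicatorConstLp 2 (μ := (volume : Measure (Fin c.m → ℝ)))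
      (measurableSet_Icc (a := 0) (b := 1)) isCompact_Icc.measure_lt_top.ne (1 : ℂ)
    refine ⟨f, 0, fun h => ?_⟩
    have h1 := norm_indicatorConstLp (p := 2) (μ := (volume : Measure (Fin c.m → ℝ)))
      (hs := measurableSet_Icc (a := 0) (b := 1)) (hμs := isCompact_Icc.measure_lt_top.ne)
      (c := (1 : ℂ)) two_ne_zero ENNReal.ofNat_ne_top
    rw [show indicatorConstLp 2 _ _ (1 : ℂ) = 0 from h, norm_zero] at h1
    simp [Measure.real, Real.volume_Icc_pi] at h1
  refine ⟨hnt, fun K hK hinv => ?_⟩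
  change Submodule ℂ (IndSpace c) at K
  have hKc : CompleteSpace K := hK.completeSpace_coe
  by_cases htop : K = ⊤
  · exact Or.inr htop
  refine Or.inl ((Submodule.eq_bot_iff K).2 fun f hf => ?_)
  have hperp : Kᗮ ≠ ⊥ := fun h => htop (Submodule.orthogonal_eq_bot_iff.1 h)
  obtain ⟨g, hg, hg0⟩ := Submodule.exists_mem_ne_zero_of_ne_bot hperp
  have h1 : ∀ t : Fin c.m → ℝ, ∀ᵐ r, ‖g r‖ₑ * ‖f (r - t)‖ₑ = 0 := by
    intro t
    set F : IndSpace c := indOp hp c (exp (c.σ t)) f with hF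
    have hFK : F ∈ K := hinv (exp (c.σ t)) f hf
    have hint : Integrable fun r => inner ℂ (g r) (F r) := L2.integrable_inner g F
    have h0 : (fun r => inner ℂ (g r) (F r)) =ᵐ[volume] 0 := by
      refine ae_eq_zero_of_integral_fourierChar_dual hint fun L => ?_
      obtain ⟨y, hy, hyL⟩ := exists_mem_polarization hp c L
      have h2 : indOp hp c (exp y) F ∈ K := hinv (exp y) F hFK
      have h3 := (Submodule.mem_orthogonal' K g).1 hg _ h2
      rw [L2.inner_def] at h3
      have h4 : ∫ r, inner ℂ (g r) (indOp hp c (exp y) F r) =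
          ∫ r, (Real.fourierChar (-ℓ y) : ℂ) *
            ((Real.fourierChar (L r) : ℂ) * inner ℂ (g r) (F r)) := by
        refine integral_congr_ae ?_
        filter_upwards [coeFn_indOp_exp hp c hy F] with r hr
        rw [hr, hyL, ← smul_eq_mul, inner_smul_right, AddChar.map_add_eq_mul, Circle.coe_mul]
        ring
      rw [h4, integral_const_mul] at h3
      exact (mul_eq_zero.1 h3).resolve_left (Circle.coe_ne_zero _)
    filter_upwards [h0, coeFn_indOp hp c (exp (c.σ t)) f] with r hr hr2
    rw [Pi.zero_apply, RCLike.inner_apply, mul_eq_zero, map_eq_zero] at hr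
    rw [← hF] at hr2
    rcases hr with hr | hr
    · rw [hr2, leftTranslate_apply hp, log_exp, c.τ_σ, mul_eq_zero] at hr
      rw [hr.resolve_left (Circle.coe_ne_zero _)]
      simp
    · rw [hr]; simp
  have hfm : StronglyMeasurable f := Lp.stronglyMeasurable f
  have hgm : StronglyMeasurable g := Lp.stronglyMeasurable g
  have h2 : ∫⁻ r, ∫⁻ t, ‖g r‖ₑ * ‖f (r - t)‖ₑ = 0 := by
    rw [lintegral_lintegral_swap]
    · have : ∀ t : Fin c.m → ℝ, ∫⁻ r, ‖g r‖ₑ * ‖f (r - t)‖ₑ = 0 := fun t => by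
        rw [lintegral_congr_ae (h1 t), lintegral_zero]
      simp [this]
    · exact ((hgm.measurable.enorm.comp measurable_fst).mul
        (hfm.measurable.enorm.comp (measurable_fst.sub measurable_snd))).aemeasurable
  have h3 : ∀ r, ∫⁻ t, ‖g r‖ₑ * ‖f (r - t)‖ₑ = ‖g r‖ₑ * ∫⁻ t, ‖f t‖ₑ := fun r => by
    rw [lintegral_const_mul _ (f := fun t => ‖f (r - t)‖ₑ)
      (hfm.measurable.enorm.comp (measurable_const.sub measurable_id)),
      lintegral_sub_left_eq_self (fun t => ‖f t‖ₑ) r]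
  simp only [h3] at h2
  rw [lintegral_mul_const _ hgm.measurable.enorm, mul_eq_zero,
    lintegral_eq_zero_iff hgm.measurable.enorm, lintegral_eq_zero_iff hfm.measurable.enorm] at h2
  rcases h2 with h2 | h2
  · refine absurd (Lp.ext ?_) hg0
    filter_upwards [h2, Lp.coeFn_zero ℂ 2 (volume : Measure (Fin c.m → ℝ))] with r hr hr0
    rw [hr0]
    simpa using hr
  · refine Lp.ext ?_
    filter_upwards [h2, Lp.coeFn_zero ℂ 2 (volume : Measure (Fin c.m → ℝ))] with r hr hr0
    rw [hr0]
    simpa using hr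

end InducedRep

end TwoStep

end

noncomputable section

namespace TwoStep

open Grp

/-! ### Convergence in the Fell topology -/

section Fell

variable {G : Type*} [Group G] [TopologicalSpace G]

theorem UnitaryRep.continuous_coeff (ρ : UnitaryRep G) (ξ : ρ.H) :
    Continuous fun x => Inner.inner ℂ ξ (ρ.ρ x ξ) :=
  continuous_const.inner (ρ.continuous_apply ξ)

theorem UnitaryRep.Equivalent.exists_coeff_eq {ρ τ : UnitaryRep G} (h : UnitaryRep.Equivalent τ ρ)
    (η : τ.H) :
    ∃ ξ : ρ.H, ∀ x, Inner.inner ℂ ξ (ρ.ρ x ξ) = Inner.inner ℂ η (τ.ρ x η) := by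
  obtain ⟨U, hU⟩ := h
  exact ⟨U η, fun x => by rw [← hU, LinearIsometryEquiv.inner_map_map]⟩

/-- Approximation of all coefficients of positive type gives convergence. -/
theorem tendsto_unitaryDual {γ : UnitaryDual G} {ρ : UnitaryRep G} (hρ : ⟦ρ⟧ = γ.1)
    {γs : ℕ → UnitaryDual G} {τ : ℕ → UnitaryRep G} (hτ : ∀ k, ⟦τ k⟧ = (γs k).1)
    (h : ∀ (ξ : ρ.H) (Q : Set G) (ε : ℝ), IsCompact Q → 0 < ε → ∀ᶠ k in atTop, ∃ η : (τ k).H,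
      ∀ x ∈ Q, ‖Inner.inner ℂ ξ (ρ.ρ x ξ) - Inner.inner ℂ η ((τ k).ρ x η)‖ < ε) :
    Tendsto γs atTop (𝓝 γ) := by
  refine TopologicalSpace.tendsto_nhds_generateFrom_iff.2 ?_
  rintro _ ⟨σ, ζ, Q, ε, -, hQ, hε, rfl⟩ ⟨τ', hτ', n, η, hη⟩
  have heq : UnitaryRep.Equivalent τ' ρ := Quotient.exact (hτ'.trans hρ.symm)
  choose ξ hξ using fun j => heq.exists_coeff_eq (η j)
  obtain ⟨δ, hδ, hle⟩ : ∃ δ > 0, ∀ x ∈ Q, ‖Inner.inner ℂ ζ (σ.ρ x ζ) -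
      ∑ j, Inner.inner ℂ (ξ j) (ρ.ρ x (ξ j))‖ + δ ≤ ε := by
    simp only [hξ]
    rcases Q.eq_empty_or_nonempty with rfl | hne
    · exact ⟨1, one_pos, by simp⟩
    · obtain ⟨x₀, hx₀, hmax⟩ := hQ.exists_isMaxOn hne
        ((σ.continuous_coeff ζ).sub (continuous_finsetSum _ fun j (_ : j ∈ Finset.univ) =>
          τ'.continuous_coeff (η j))).norm.continuousOn
      refine ⟨ε - _, sub_pos.2 (hη x₀ hx₀), fun x hx => ?_⟩
      have h1 : ‖Inner.inner ℂ ζ (σ.ρ x ζ) - ∑ j, Inner.inner ℂ (η j) (τ'.ρ x (η j))‖ ≤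
        ‖Inner.inner ℂ ζ (σ.ρ x₀ ζ) - ∑ j, Inner.inner ℂ (η j) (τ'.ρ x₀ (η j))‖ := hmax hx
      linarith
  have hev : ∀ᶠ k in atTop, ∀ j, ∃ η' : (τ k).H, ∀ x ∈ Q,
      ‖Inner.inner ℂ (ξ j) (ρ.ρ x (ξ j)) - Inner.inner ℂ η' ((τ k).ρ x η')‖ < δ / (n + 1) :=
    eventually_all.2 fun j => h (ξ j) Q _ hQ (by positivity)
  filter_upwards [hev] with k hk
  choose η' hη' using hk
  refine ⟨τ k, hτ k, n, η', fun x hx => ?_⟩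
  have h1 : ‖∑ j, Inner.inner ℂ (ξ j) (ρ.ρ x (ξ j)) -
      ∑ j, Inner.inner ℂ (η' j) ((τ k).ρ x (η' j))‖ ≤ n * (δ / (n + 1)) := by
    rw [← Finset.sum_sub_distrib]
    refine (norm_sum_le_of_le _ fun j _ => (hη' j x hx).le).trans ?_
    simp
  have h2 : n * (δ / (n + 1)) < δ := by
    rw [mul_div_assoc', div_lt_iff₀ (by positivity)]
    nlinarith
  calc _ = ‖(Inner.inner ℂ ζ (σ.ρ x ζ) - ∑ j, Inner.inner ℂ (ξ j) (ρ.ρ x (ξ j))) +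
        (∑ j, Inner.inner ℂ (ξ j) (ρ.ρ x (ξ j)) -
          ∑ j, Inner.inner ℂ (η' j) ((τ k).ρ x (η' j)))‖ := by congr 1; ring
    _ ≤ _ := norm_add_le _ _
    _ < ε := by linarith [hle x hx]

theorem eventually_mem_fellNhd {γ : UnitaryDual G} {ρ : UnitaryRep G} (hρ : ⟦ρ⟧ = γ.1)
    (hirr : ρ.IsIrreducible) {γs : ℕ → UnitaryDual G} (h : Tendsto γs atTop (𝓝 γ)) (ξ : ρ.H)
    {Q : Set G} (hQ : IsCompact Q) {ε : ℝ} (hε : 0 < ε) :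
    ∀ᶠ k in atTop, γs k ∈ fellNhd ρ ξ Q ε := by
  refine h.eventually_mem (IsOpen.mem_nhds ?_ ?_)
  · exact TopologicalSpace.isOpen_generateFrom_of_mem ⟨ρ, ξ, Q, ε, hirr, hQ, hε, rfl⟩
  · exact ⟨ρ, hρ, 1, fun _ => ξ, fun x _ => by simpa using hε⟩

theorem norm_coeff_sub_le (ρ : UnitaryRep G) (ξ ξ' : ρ.H) (x : G) :
    ‖Inner.inner ℂ ξ (ρ.ρ x ξ) - Inner.inner ℂ ξ' (ρ.ρ x ξ')‖ ≤ (‖ξ‖ + ‖ξ'‖) * ‖ξ - ξ'‖ := by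
  have h : Inner.inner ℂ ξ (ρ.ρ x ξ) - Inner.inner ℂ ξ' (ρ.ρ x ξ') =
      Inner.inner ℂ ξ (ρ.ρ x (ξ - ξ')) + Inner.inner ℂ (ξ - ξ') (ρ.ρ x ξ') := by
    rw [map_sub, inner_sub_right, inner_sub_left]; ring
  rw [h]
  refine (norm_add_le _ _).trans ?_
  have h1 := norm_inner_le_norm (𝕜 := ℂ) ξ (ρ.ρ x (ξ - ξ'))
  have h2 := norm_inner_le_norm (𝕜 := ℂ) (ξ - ξ') (ρ.ρ x ξ')
  rw [LinearIsometryEquiv.norm_map] at h1 h2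
  linarith

end Fell

section FellTwoStep

variable {𝔤 : Type*} [LieRing 𝔤] [LieAlgebra ℝ 𝔤] [FiniteDimensional ℝ 𝔤]
  [TopologicalSpace 𝔤] [IsTopologicalAddGroup 𝔤] [ContinuousSMul ℝ 𝔤] [T2Space 𝔤] [IsTwoStep 𝔤]

/-- Convergence of functionals implies convergence of the corresponding representations. -/
theorem ActsBy.tendsto {γ : UnitaryDual (Grp 𝔤)} {ρ : UnitaryRep (Grp 𝔤)} (hρ : ⟦ρ⟧ = γ.1)
    (hirr : ρ.IsIrreducible) {m : Module.Dual ℝ 𝔤} (hm : ActsBy ρ m)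
    {γs : ℕ → UnitaryDual (Grp 𝔤)} {τ : ℕ → UnitaryRep (Grp 𝔤)} (hτ : ∀ k, ⟦τ k⟧ = (γs k).1)
    (hnt : ∀ k, Nontrivial (τ k).H) {ms : ℕ → Module.Dual ℝ 𝔤} (hms : ∀ k, ActsBy (τ k) (ms k))
    (hlim : Tendsto ms atTop (𝓝 m)) : Tendsto γs atTop (𝓝 γ) := by
  refine tendsto_unitaryDual hρ hτ fun ξ Q ε hQ hε => ?_
  have := hirr.1
  obtain ⟨ξ₀, hξ₀, hc⟩ := hm.exists_gaussian_vector
  choose η₀ hη₀ hc' using fun k => (hms k).exists_gaussian_vector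
  obtain ⟨f, hf⟩ : ∃ f, (‖ξ‖ + ‖ρ.orbitMap ξ₀ f‖) * ‖ξ - ρ.orbitMap ξ₀ f‖ < ε / 2 := by
    have hopen : IsOpen {ξ' : ρ.H | (‖ξ‖ + ‖ξ'‖) * ‖ξ - ξ'‖ < ε / 2} :=
      isOpen_lt (by fun_prop) continuous_const
    exact (hirr.denseRange_orbitMap (norm_ne_zero_iff.1 (by simp [hξ₀]))).exists_mem_open hopen
      ⟨ξ, by simpa using hε⟩
  let Ψ : Module.Dual ℝ 𝔤 × Grp 𝔤 → ℂ := fun z => ∑ y ∈ f.support, ∑ w ∈ f.support,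
    (starRingEnd ℂ) (f y) * f w * gaussCoeff z.1 (y⁻¹ * z.2 * w)
  have hΨ : Continuous Ψ := by
    refine continuous_finsetSum _ fun y _ => continuous_finsetSum _ fun w _ =>
      continuous_const.mul ?_
    have h1 : Continuous fun z : Module.Dual ℝ 𝔤 × Grp 𝔤 => y⁻¹ * z.2 :=
      continuous_grp_mul.comp (continuous_const.prodMk continuous_snd)
    have h2 : Continuous fun z : Module.Dual ℝ 𝔤 × Grp 𝔤 => y⁻¹ * z.2 * w :=
      continuous_grp_mul.comp (h1.prodMk continuous_const)
    have h3 : Continuous fun z : Module.Dual ℝ 𝔤 × Grp 𝔤 => (z.1, y⁻¹ * z.2 * w) :=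
      continuous_fst.prodMk h2
    have h4 := Continuous.comp continuous_gaussCoeff h3
    exact h4
  have hev : ∀ᶠ m' in 𝓝 m, ∀ x ∈ Q, ‖Ψ (m, x) - Ψ (m', x)‖ < ε / 2 := by
    refine hQ.eventually_forall_of_forall_eventually fun x _ => ?_
    have hc : Continuous fun z : Module.Dual ℝ 𝔤 × Grp 𝔤 => ‖Ψ (m, z.2) - Ψ z‖ :=
      ((hΨ.comp (continuous_const.prodMk continuous_snd)).sub hΨ).norm
    exact (isOpen_lt hc continuous_const).mem_nhds (by simpa using hε)
  filter_upwards [hlim.eventually hev] with k hk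
  refine ⟨(τ k).orbitMap (η₀ k) f, fun x hx => ?_⟩
  have h1 : inner ℂ (ρ.orbitMap ξ₀ f) (ρ.ρ x (ρ.orbitMap ξ₀ f)) = Ψ (m, x) := by
    rw [UnitaryRep.inner_orbitMap]; simp only [hc, Ψ]
  have h2 : inner ℂ ((τ k).orbitMap (η₀ k) f) ((τ k).ρ x ((τ k).orbitMap (η₀ k) f)) =
      Ψ (ms k, x) := by
    rw [UnitaryRep.inner_orbitMap]; simp only [hc', Ψ]
  have h3 := norm_coeff_sub_le ρ ξ (ρ.orbitMap ξ₀ f) x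
  rw [h1] at h3
  rw [h2]
  calc _ = ‖(inner ℂ ξ (ρ.ρ x ξ) - Ψ (m, x)) + (Ψ (m, x) - Ψ (ms k, x))‖ := by congr 1; ring
    _ ≤ _ := norm_add_le _ _
    _ < ε := by linarith [hk x hx]

theorem ActsBy.of_equivalent {ρ τ : UnitaryRep (Grp 𝔤)} {m : Module.Dual ℝ 𝔤} (h : ActsBy ρ m)
    (he : UnitaryRep.Equivalent τ ρ) : ActsBy τ m := by
  obtain ⟨U, hU⟩ := he
  intro x hx ξ
  apply U.injective
  rw [hU, h x hx, map_smul]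

theorem ActsBy.congr {ρ : UnitaryRep (Grp 𝔤)} {m m' : Module.Dual ℝ 𝔤} (h : ActsBy ρ m)
    (hr : radical m' = radical m) (hm : ∀ x ∈ radical m, m' x = m x) : ActsBy ρ m' := by
  intro x hx ξ
  rw [hr] at hx
  rw [hm x hx]
  exact h x hx ξ

/-- A limit of representations acts by the limit character on limits of radical elements. -/
theorem rho_exp_of_tendsto {γ : UnitaryDual (Grp 𝔤)} {ρ : UnitaryRep (Grp 𝔤)} (hρ : ⟦ρ⟧ = γ.1)
    (hirr : ρ.IsIrreducible) {γs : ℕ → UnitaryDual (Grp 𝔤)} {τ : ℕ → UnitaryRep (Grp 𝔤)}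
    (hτ : ∀ k, ⟦τ k⟧ = (γs k).1) {ℓ : Module.Dual ℝ 𝔤} {ℓs : ℕ → Module.Dual ℝ 𝔤}
    (hℓs : ∀ k, ActsBy (τ k) (ℓs k)) (hlim : Tendsto ℓs atTop (𝓝 ℓ))
    (hγ : Tendsto γs atTop (𝓝 γ)) {x : 𝔤} {xs : ℕ → 𝔤} (hx : Tendsto xs atTop (𝓝 x))
    (hxs : ∀ᶠ k in atTop, xs k ∈ radical (ℓs k)) (ξ : ρ.H) :
    ρ.ρ (exp x) ξ = (Real.fourierChar (-ℓ x) : ℂ) • ξ := by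
  have hxe : Tendsto (fun k => (exp (xs k) : Grp 𝔤)) atTop (𝓝 (exp x)) := hx
  have hfc : Continuous fun t : ℝ => (Real.fourierChar (-t) : ℂ) :=
    continuous_subtype_val.comp (Real.continuous_fourierChar.comp continuous_neg)
  have hval : Tendsto (fun k => ℓs k (xs k)) atTop (𝓝 (ℓ x)) :=
    (continuous_dual_apply.tendsto (ℓ, x)).comp (hlim.prodMk_nhds hx)
  have h1 : Tendsto (fun k => inner ℂ ξ (ρ.ρ (exp (xs k)) ξ) -
      (Real.fourierChar (-ℓs k (xs k)) : ℂ) * inner ℂ ξ ξ) atTop (𝓝 0) := by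
    rw [Metric.tendsto_nhds]
    intro ε hε
    have hQ : IsCompact (insert (1 : Grp 𝔤)
        (insert (exp x) (Set.range fun k => (exp (xs k) : Grp 𝔤)))) :=
      hxe.isCompact_insert_range.insert 1
    filter_upwards [eventually_mem_fellNhd hρ hirr hγ ξ hQ (half_pos hε), hxs] with k hk hxk
    obtain ⟨τ', hτ', n, η, hη⟩ := hk
    have hact : ActsBy τ' (ℓs k) :=
      (hℓs k).of_equivalent (Quotient.exact (hτ'.trans (hτ k).symm))
    have e1 := hη 1 (Or.inl rfl)
    have e2 := hη (exp (xs k)) (Or.inr (Or.inr ⟨k, rfl⟩))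
    simp only [hact _ hxk, inner_smul_right, map_one, LinearIsometryEquiv.coe_one, id] at e1 e2
    rw [← Finset.mul_sum] at e2
    rw [dist_zero_right]
    set z : ℂ := (Real.fourierChar (-ℓs k (xs k)) : ℂ)
    have hz : ‖z‖ = 1 := Circle.norm_coe _
    set S := ∑ j, inner ℂ (η j) (η j)
    calc _ = ‖(inner ℂ ξ (ρ.ρ (exp (xs k)) ξ) - z * S) - z * (inner ℂ ξ ξ - S)‖ := by
          congr 1; ring
      _ ≤ ‖inner ℂ ξ (ρ.ρ (exp (xs k)) ξ) - z * S‖ + ‖z * (inner ℂ ξ ξ - S)‖ := norm_sub_le _ _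
      _ < ε := by rw [norm_mul, hz, one_mul]; linarith
  have h2 : Tendsto (fun k => inner ℂ ξ (ρ.ρ (exp (xs k)) ξ) -
      (Real.fourierChar (-ℓs k (xs k)) : ℂ) * inner ℂ ξ ξ) atTop
      (𝓝 (inner ℂ ξ (ρ.ρ (exp x) ξ) - (Real.fourierChar (-ℓ x) : ℂ) * inner ℂ ξ ξ)) :=
    (((ρ.continuous_coeff ξ).tendsto _).comp hxe).sub
      (((hfc.tendsto _).comp hval).mul_const _)
  have h3 := tendsto_nhds_unique h2 h1
  rw [sub_eq_zero] at h3
  set z : ℂ := (Real.fourierChar (-ℓ x) : ℂ)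
  have hz : ‖z‖ = 1 := Circle.norm_coe _
  rw [← sub_eq_zero, ← norm_eq_zero, ← sq_eq_zero_iff, norm_sub_sq (𝕜 := ℂ), inner_smul_right,
    ← inner_conj_symm, h3, norm_smul, hz, one_mul, LinearIsometryEquiv.norm_map]
  have h4 : z * (starRingEnd ℂ) (z * inner ℂ ξ ξ) = ((‖ξ‖ ^ 2 : ℝ) : ℂ) := by
    rw [map_mul, inner_conj_symm, ← mul_assoc, Complex.mul_conj, Complex.normSq_eq_norm_sq, hz,
      inner_self_eq_norm_sq_to_K]
    simp
  rw [h4, show RCLike.re ((‖ξ‖ ^ 2 : ℝ) : ℂ) = ‖ξ‖ ^ 2 from Complex.ofReal_re _]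
  ring

theorem eq_zero_of_forall_fourierChar {a : ℝ} (h : ∀ t : ℝ, (Real.fourierChar (t * a) : ℂ) = 1) :
    a = 0 := by
  by_contra ha
  have h1 := h (1 / (2 * a))
  rw [show 1 / (2 * a) * a = 1 / 2 by field_simp, Real.fourierChar_apply] at h1
  rw [show ((2 * Real.pi * (1 / 2) : ℝ) : ℂ) * Complex.I = Real.pi * Complex.I by push_cast; ring,
    Complex.exp_pi_mul_I] at h1
  norm_num at h1

/-- An irreducible representation in which `[G, G]` acts by `χ_ℓ` is determined by a
functional that extends `ℓ`. -/
theorem exists_actsBy {ρ : UnitaryRep (Grp 𝔤)} (hirr : ρ.IsIrreducible) {ℓ : Module.Dual ℝ 𝔤}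
    {u : Submodule ℝ 𝔤} (hu : ∀ x y : 𝔤, ⁅x, y⁆ ∈ u) (hle : u ≤ radical ℓ)
    (h : ∀ x ∈ u, ∀ ξ : ρ.H, ρ.ρ (exp x) ξ = (Real.fourierChar (-ℓ x) : ℂ) • ξ) :
    ∃ m : Module.Dual ℝ 𝔤, m - ℓ ∈ u.dualAnnihilator ∧ ActsBy ρ m := by
  have hcomm : ∀ (x : radical ℓ) (y : Grp 𝔤) (ξ : ρ.H),
      ρ.ρ (exp x.1) (ρ.ρ y ξ) = ρ.ρ y (ρ.ρ (exp x.1) ξ) := by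
    intro x y ξ
    have h1 : (exp x.1 * y : Grp 𝔤) = y * exp x.1 * exp ⁅x.1, log y⁆ := by
      apply log_injective
      simp only [log_mul, log_exp, lie_add, add_lie, lie_smul, smul_lie, lie_lie_left,
        IsTwoStep.lie_lie_eq_zero, smul_zero, add_zero]
      rw [← lie_skew (log y) x.1]
      module
    rw [← UnitaryRep.rho_mul_apply, h1, UnitaryRep.rho_mul_apply, UnitaryRep.rho_mul_apply,
      h _ (hu _ _), x.2, neg_zero, AddChar.map_zero_eq_one, Circle.coe_one, one_smul]
  choose θ hθ using fun x : radical ℓ => hirr.exists_scalar_of_commute (ρ.ρ (exp x.1)) (hcomm x)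
  have := hirr.1
  obtain ⟨ξ₀, hξ₀⟩ := exists_norm_eq ρ.H zero_le_one
  have hne : ξ₀ ≠ 0 := norm_ne_zero_iff.1 (by simp [hξ₀])
  have hθ' : ∀ x, θ x = inner ℂ ξ₀ (ρ.ρ (exp x.1) ξ₀) := fun x => by
    rw [hθ, inner_smul_right, inner_self_eq_norm_sq_to_K, hξ₀]; simp
  have hθc : Continuous θ := by
    rw [funext hθ']
    exact (ρ.continuous_coeff ξ₀).comp (continuous_exp.comp continuous_subtype_val)
  have hθn : ∀ x, ‖θ x‖ = 1 := fun x => by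
    have h1 := congrArg norm (hθ x ξ₀)
    rw [LinearIsometryEquiv.norm_map, norm_smul, hξ₀, mul_one] at h1
    exact h1.symm
  have hθm : ∀ x y, θ (x + y) = θ x * θ y := fun x y => by
    have h1 : (exp x.1 * exp y.1 : Grp 𝔤) =
        exp (x + y : radical ℓ).1 * exp ((1 / 2 : ℝ) • ⁅x.1, y.1⁆) := by
      apply log_injective
      simp only [log_mul, log_exp, lie_smul, IsTwoStep.lie_lie_eq_zero, smul_zero, add_zero]
      rfl
    have h2 : ρ.ρ (exp x.1 * exp y.1) ξ₀ = θ (x + y) • ξ₀ := by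
      rw [h1, UnitaryRep.rho_mul_apply, h _ (u.smul_mem _ (hu _ _)), map_smul ℓ, x.2, smul_zero,
        neg_zero, AddChar.map_zero_eq_one, Circle.coe_one, one_smul, hθ]
    rw [UnitaryRep.rho_mul_apply, hθ y, map_smul, hθ x, smul_smul, mul_comm] at h2
    exact (smul_left_injective ℂ hne h2).symm
  obtain ⟨μ, hμ⟩ := exists_dual_of_character hθc hθm hθn
  obtain ⟨m, hm⟩ := LinearMap.exists_extend μ
  have hm' : ∀ x (hx : x ∈ radical ℓ), m x = μ ⟨x, hx⟩ := fun x hx =>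
    congrArg (fun L : (radical ℓ) →ₗ[ℝ] ℝ => L ⟨x, hx⟩) hm
  have hmu : m - ℓ ∈ u.dualAnnihilator := by
    rw [Submodule.mem_dualAnnihilator]
    intro x hx
    refine eq_zero_of_forall_fourierChar fun t => ?_
    have hx' := u.smul_mem t hx
    have h1 := h _ hx' ξ₀
    have h2 := hθ ⟨t • x, hle hx'⟩ ξ₀
    rw [hμ, ← hm', h1] at h2
    have h3 : (Real.fourierChar (-ℓ (t • x)) : ℂ) = (Real.fourierChar (-m (t • x)) : ℂ) :=
      smul_left_injective ℂ hne h2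
    rw [show t * (m - ℓ) x = -ℓ (t • x) + m (t • x) by
      rw [map_smul, map_smul, LinearMap.sub_apply]; simp only [smul_eq_mul]; ring,
      AddChar.map_add_eq_mul, Circle.coe_mul, h3, ← Circle.coe_mul, ← AddChar.map_add_eq_mul,
      neg_add_cancel, AddChar.map_zero_eq_one, Circle.coe_one]
  refine ⟨m, hmu, fun x hx ξ => ?_⟩
  rw [radical_eq_of_lie_eq (lie_eq_of_sub_mem hu hmu)] at hx
  rw [hθ ⟨x, hx⟩, hμ, hm' x hx]

theorem actsBy_twist {ρ : UnitaryRep (Grp 𝔤)} {ℓ q : Module.Dual ℝ 𝔤} (h : ActsBy ρ ℓ)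
    (hq : IsChar q) :
    ActsBy (ρ.twist (unitaryChar q hq) (continuous_unitaryChar q hq)) (ℓ + q) := by
  have hrad : radical (ℓ + q) = radical ℓ :=
    radical_eq_of_lie_eq fun x y => by rw [LinearMap.add_apply, hq, add_zero]
  intro x hx ξ
  rw [hrad] at hx
  change ρ.H at ξ
  change (Real.fourierChar (-q x) : ℂ) • ρ.ρ (exp x) ξ = (Real.fourierChar (-(ℓ + q) x) : ℂ) • ξ
  rw [h x hx, smul_smul, ← Circle.coe_mul, ← AddChar.map_add_eq_mul, LinearMap.add_apply,
    neg_add_rev]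

/-- The limits of representations with Kirillov orbits `O k`. -/
theorem limitSet_unitaryDual {O : ℕ → OrbitSpace 𝔤} {ℓ : Module.Dual ℝ 𝔤}
    {ℓs : ℕ → Module.Dual ℝ 𝔤} (hℓs : ∀ k, ℓs k ∈ (O k).orbit) (hlim : Tendsto ℓs atTop (𝓝 ℓ))
    {u : Submodule ℝ 𝔤} (hu : ∀ x y : 𝔤, ⁅x, y⁆ ∈ u) (hle : u ≤ radical ℓ)
    (hux : ∀ x ∈ u, ∃ xs : ℕ → 𝔤, Tendsto xs atTop (𝓝 x) ∧
      ∀ᶠ k in atTop, xs k ∈ radical (ℓs k))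
    (hL : ∀ q ∈ u.dualAnnihilator, ∃ ms : ℕ → Module.Dual ℝ 𝔤,
      (∀ k, ms k ∈ (O k).orbit) ∧ Tendsto ms atTop (𝓝 (ℓ + q)))
    (γs : ℕ → UnitaryDual (Grp 𝔤)) (hγs : ∀ k, IsKirillovOrbit (O k) (γs k))
    {p : LieSubalgebra ℝ 𝔤} (hp : IsPolarization ℓ p) (c : Coords p) :
    (fun γ : UnitaryDual (Grp 𝔤) => γ.1) '' limitSet γs =
      {C : RepClass (Grp 𝔤) | ∃ (q : Module.Dual ℝ 𝔤) (hq : IsChar q),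
        q ∈ u.dualAnnihilator ∧
        C = ⟦(inducedRep hp c).twist (unitaryChar q hq) (continuous_unitaryChar q hq)⟧} := by
  choose m' hm' p' hp' c' hc' using hγs
  have hact : ∀ (ms : ℕ → Module.Dual ℝ 𝔤), (∀ k, ms k ∈ (O k).orbit) →
      ∀ k, ActsBy (inducedRep (hp' k) (c' k)) (ms k) := fun ms hms k =>
    (actsBy_inducedRep (hp' k) (c' k)).congr (radical_eq_of_mem (hm' k) (hms k))
      fun x hx => eq_on_radical_of_mem (hm' k) (hms k) hx
  have hirr := isIrreducible_inducedRep hp c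
  ext C
  constructor
  · rintro ⟨γ, hγ, rfl⟩
    obtain ⟨ρ, hρirr, hρ⟩ := γ.2
    obtain ⟨m, hm, hmact⟩ := exists_actsBy hρirr hu hle fun x hx ξ => by
      obtain ⟨xs, hxs, hxr⟩ := hux x hx
      exact rho_exp_of_tendsto hρ hρirr (fun k => (hc' k).symm) (hact ℓs hℓs) hlim hγ hxs hxr ξ
    have hq : IsChar (m - ℓ) := fun x y => (Submodule.mem_dualAnnihilator _).1 hm _ (hu x y)
    refine ⟨m - ℓ, hq, hm, ?_⟩
    have h1 := actsBy_twist (actsBy_inducedRep hp c) hq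
    rw [add_sub_cancel] at h1
    change γ.1 = _
    rw [← hρ]
    exact Quotient.sound (hmact.equivalent h1 hρirr (hirr.twist _ _))
  · rintro ⟨q, hq, hqu, rfl⟩
    obtain ⟨ms, hms, hmlim⟩ := hL q hqu
    have hirr' := hirr.twist (unitaryChar q hq) (continuous_unitaryChar q hq)
    refine ⟨⟨_, _, hirr', rfl⟩, ?_, rfl⟩
    exact ActsBy.tendsto rfl hirr' (actsBy_twist (actsBy_inducedRep hp c) hq)
      (fun k => (hc' k).symm) (fun k => (isIrreducible_inducedRep (hp' k) (c' k)).1)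
      (hact ms hms) hmlim

end FellTwoStep

end TwoStep

end

noncomputable section

namespace TwoStep

open Grp

/-! ### Convergence of subspaces -/

section Frames

open RealInnerProductSpace

variable {E : Type*} [NormedAddCommGroup E] [InnerProductSpace ℝ E]

/-- Orthonormal bases `c k` of the subspaces `V k` converge to `c₀`. -/
structure IsFrameLimit {m : ℕ} (V : ℕ → Submodule ℝ E) (c : ℕ → Fin m → E) (c₀ : Fin m → E) :
    Prop where
  orthonormal : ∀ k, Orthonormal ℝ (c k)
  span_eq : ∀ k, Submodule.span ℝ (Set.range (c k)) = V k
  tendsto : ∀ i, Tendsto (fun k => c k i) atTop (𝓝 (c₀ i))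

theorem sum_inner_smul_of_mem_span {m : ℕ} {c : Fin m → E} (hc : Orthonormal ℝ c) {x : E}
    (hx : x ∈ Submodule.span ℝ (Set.range c)) : ∑ i, ⟪c i, x⟫ • c i = x := by
  induction hx using Submodule.span_induction with
  | mem x hx =>
    obtain ⟨j, rfl⟩ := hx
    simp [orthonormal_iff_ite.1 hc]
  | zero => simp
  | add x y _ _ hx hy => simp only [inner_add_right, add_smul, Finset.sum_add_distrib, hx, hy]
  | smul a x _ hx =>
    simp only [inner_smul_right, mul_smul, ← Finset.smul_sum, hx]

namespace IsFrameLimit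

variable {m : ℕ} {V : ℕ → Submodule ℝ E} {c : ℕ → Fin m → E} {c₀ : Fin m → E}

theorem orthonormal_limit (h : IsFrameLimit V c c₀) : Orthonormal ℝ c₀ := by
  rw [orthonormal_iff_ite]
  intro i j
  refine tendsto_nhds_unique ((h.tendsto i).inner (h.tendsto j)) ?_
  simp only [orthonormal_iff_ite.1 (h.orthonormal _)]
  exact tendsto_const_nhds

theorem mem (h : IsFrameLimit V c c₀) (k : ℕ) (i : Fin m) : c k i ∈ V k := by
  rw [← h.span_eq]
  exact Submodule.subset_span ⟨i, rfl⟩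

theorem finrank_eq (h : IsFrameLimit V c c₀) (k : ℕ) : Module.finrank ℝ (V k) = m := by
  rw [← h.span_eq, finrank_span_eq_card (h.orthonormal k).linearIndependent, Fintype.card_fin]

theorem finrank_limit (h : IsFrameLimit V c c₀) :
    Module.finrank ℝ (Submodule.span ℝ (Set.range c₀)) = m := by
  rw [finrank_span_eq_card h.orthonormal_limit.linearIndependent, Fintype.card_fin]

theorem tendsto_sum (h : IsFrameLimit V c c₀) (x : E) :
    Tendsto (fun k => ∑ i, ⟪c k i, x⟫ • c k i) atTop (𝓝 (∑ i, ⟪c₀ i, x⟫ • c₀ i)) :=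
  tendsto_finsetSum _ fun i _ => ((h.tendsto i).inner tendsto_const_nhds).smul (h.tendsto i)

theorem mem_span_of_forall_mem (h : IsFrameLimit V c c₀) {x : E} (hx : ∀ k, x ∈ V k) :
    x ∈ Submodule.span ℝ (Set.range c₀) := by
  have h1 : ∑ i, ⟪c₀ i, x⟫ • c₀ i = x := by
    refine tendsto_nhds_unique (h.tendsto_sum x) ?_
    simp only [sum_inner_smul_of_mem_span (h.orthonormal _) ((h.span_eq _).symm ▸ hx _)]
    exact tendsto_const_nhds
  rw [← h1]
  exact Submodule.sum_mem _ fun i _ => Submodule.smul_mem _ _ (Submodule.subset_span ⟨i, rfl⟩)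

theorem starProjection_eq [FiniteDimensional ℝ E] (h : IsFrameLimit V c c₀) (k : ℕ) (x : E) :
    (V k).starProjection x = ∑ i, ⟪c k i, x⟫ • c k i := by
  refine Submodule.eq_starProjection_of_mem_orthogonal
    (Submodule.sum_mem _ fun i _ => Submodule.smul_mem _ _ (h.mem k i)) ?_
  rw [Submodule.mem_orthogonal]
  intro y hy
  rw [← h.span_eq] at hy
  rw [← sum_inner_smul_of_mem_span (h.orthonormal k) hy, sum_inner]
  refine Finset.sum_eq_zero fun j _ => ?_
  rw [inner_smul_left, inner_sub_right, inner_sum]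
  simp [inner_smul_right, orthonormal_iff_ite.1 (h.orthonormal k)]

end IsFrameLimit

variable [FiniteDimensional ℝ E]

/-- Compactness of the Grassmannian. -/
theorem exists_isFrameLimit (V : ℕ → Submodule ℝ E) :
    ∃ θ : ℕ → ℕ, StrictMono θ ∧ ∃ (m : ℕ) (c : ℕ → Fin m → E) (c₀ : Fin m → E),
      IsFrameLimit (V ∘ θ) c c₀ := by
  classical
  let f : ℕ → Fin (Module.finrank ℝ E + 1) := fun k =>
    ⟨Module.finrank ℝ (V k), Nat.lt_succ_of_le (Submodule.finrank_le _)⟩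
  obtain ⟨m, hm⟩ := Finite.exists_infinite_fiber f
  let φ := Nat.orderEmbeddingOfSet (f ⁻¹' {m})
  have hφ : ∀ k, Module.finrank ℝ (V (φ k)) = m := fun k => by
    have h1 : φ k ∈ f ⁻¹' {m} := by
      rw [← Nat.orderEmbeddingOfSet_range (f ⁻¹' {m})]
      exact ⟨k, rfl⟩
    exact congrArg Fin.val (Set.mem_singleton_iff.1 h1)
  let b : ∀ k, OrthonormalBasis (Fin m) ℝ (V (φ k)) := fun k =>
    (stdOrthonormalBasis ℝ (V (φ k))).reindex (finCongr (hφ k))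
  let c : ℕ → Fin m → E := fun k i => (b k i : E)
  have hc : ∀ k, Orthonormal ℝ (c k) := fun k =>
    (b k).orthonormal.comp_linearIsometry (V (φ k)).subtypeₗᵢ
  have hspan : ∀ k, Submodule.span ℝ (Set.range (c k)) = V (φ k) := fun k => by
    have h1 : Set.range (c k) = (V (φ k)).subtype '' Set.range (b k) := by
      rw [← Set.range_comp]; rfl
    rw [h1, Submodule.span_image, ← (b k).coe_toBasis, (b k).toBasis.span_eq, Submodule.map_top,
      Submodule.range_subtype]
  obtain ⟨c₀, -, ψ, hψ, hlim⟩ := (isCompact_closedBall (0 : Fin m → E) 1).tendsto_subseq (x := c)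
    fun k => by
      rw [mem_closedBall_zero_iff, pi_norm_le_iff_of_nonneg zero_le_one]
      exact fun i => ((hc k).1 i).le
  exact ⟨φ ∘ ψ, φ.strictMono.comp hψ, m, c ∘ ψ, c₀, fun k => hc _, fun k => hspan _,
    tendsto_pi_nhds.1 hlim⟩

/-- If all frame limits of subsequences span the same subspace, the whole sequence converges. -/
theorem subspaceTendsto_of_forall_isFrameLimit {V : ℕ → Submodule ℝ E} {U : Submodule ℝ E}
    (h : ∀ θ : ℕ → ℕ, StrictMono θ → ∀ (m : ℕ) (c : ℕ → Fin m → E) (c₀ : Fin m → E),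
      IsFrameLimit (V ∘ θ) c c₀ → Submodule.span ℝ (Set.range c₀) = U) :
    SubspaceTendsto V U := by
  have hdim : ∀ᶠ k in atTop, Module.finrank ℝ (V k) = Module.finrank ℝ U := by
    by_contra hcon
    obtain ⟨φ, hφ, hne⟩ := extraction_of_frequently_atTop (not_eventually.1 hcon)
    obtain ⟨θ, hθ, m, c, c₀, hF⟩ := exists_isFrameLimit (V ∘ φ)
    refine hne (θ 0) ?_
    rw [← h (φ ∘ θ) (hφ.comp hθ) m c c₀ hF, hF.finrank_limit]
    exact hF.finrank_eq 0
  have hproj : ∀ x ∈ U, Tendsto (fun k => (V k).starProjection x) atTop (𝓝 x) := by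
    intro x hx
    refine tendsto_of_subseq_tendsto fun ns hns => ?_
    obtain ⟨φ, -, hφ⟩ := strictMono_subseq_of_tendsto_atTop hns
    obtain ⟨θ, hθ, m, c, c₀, hF⟩ := exists_isFrameLimit (V ∘ ns ∘ φ)
    refine ⟨φ ∘ θ, ?_⟩
    have h1 := hF.tendsto_sum x
    rw [sum_inner_smul_of_mem_span hF.orthonormal_limit
      (by rw [h _ (hφ.comp hθ) m c c₀ hF]; exact hx)] at h1
    exact h1.congr fun k => (hF.starProjection_eq k x).symm
  let b := stdOrthonormalBasis ℝ U
  let b₀ : Fin (Module.finrank ℝ U) → E := fun i => (b i : E)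
  have hb₀ : LinearIndependent ℝ b₀ :=
    (b.orthonormal.comp_linearIsometry U.subtypeₗᵢ).linearIndependent
  have hlim : ∀ i, Tendsto (fun k => (V k).starProjection (b₀ i)) atTop (𝓝 (b₀ i)) := fun i =>
    hproj _ (b i).2
  refine ⟨Module.finrank ℝ U, fun k i => (V k).starProjection (b₀ i), b₀, ⟨hb₀, ?_⟩, ?_, hlim⟩
  · have h1 : Set.range b₀ = U.subtype '' Set.range b := by
      rw [← Set.range_comp]; rfl
    rw [h1, Submodule.span_image, ← b.coe_toBasis, b.toBasis.span_eq, Submodule.map_top,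
      Submodule.range_subtype]
  · have hopen := (isOpen_setOfPred_linearIndependent (𝕜 := ℝ) (E := E)
      (ι := Fin (Module.finrank ℝ U))).mem_nhds hb₀
    filter_upwards [hdim, (tendsto_pi_nhds.2 hlim).eventually_mem hopen] with k hk hli
    refine ⟨hli, Submodule.eq_of_le_of_finrank_eq ?_ ?_⟩
    · rw [Submodule.span_le]
      rintro _ ⟨i, rfl⟩
      exact Submodule.starProjection_apply_mem _ _
    · rw [finrank_span_eq_card hli, Fintype.card_fin, hk]

end Frames

theorem SubspaceTendsto.map_symm {V V' : Type*} [AddCommGroup V] [Module ℝ V] [TopologicalSpace V]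
    [AddCommGroup V'] [Module ℝ V'] [TopologicalSpace V'] (e : V ≃L[ℝ] V')
    {W : ℕ → Submodule ℝ V} {W₀ : Submodule ℝ V}
    (h : SubspaceTendsto (fun k => (W k).map e.toLinearMap) (W₀.map e.toLinearMap)) :
    SubspaceTendsto W W₀ := by
  obtain ⟨m, b, b₀, h₀, hk, hlim⟩ := h
  have key : ∀ (b : Fin m → V') (W : Submodule ℝ V), LinearIndependent ℝ b ∧
      Submodule.span ℝ (Set.range b) = W.map e.toLinearMap →
      LinearIndependent ℝ (fun i => e.symm (b i)) ∧
      Submodule.span ℝ (Set.range fun i => e.symm (b i)) = W := by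
    rintro b W ⟨h1, h2⟩
    refine ⟨h1.map' e.symm.toLinearMap (LinearMap.ker_eq_bot.2 e.symm.injective), ?_⟩
    have h3 : (Set.range fun i => e.symm (b i)) = e.symm.toLinearMap '' Set.range b := by
      rw [← Set.range_comp]; rfl
    rw [h3, Submodule.span_image, h2, ← Submodule.map_comp]
    convert Submodule.map_id W
    ext x
    simp
  exact ⟨m, fun k i => e.symm (b k i), fun i => e.symm (b₀ i), key b₀ W₀ h₀,
    hk.mono fun k => key (b k) (W k), fun i => (e.symm.continuous.tendsto _).comp (hlim i)⟩

theorem SubspaceTendsto.eventually_finrank_eq {V : Type*} [AddCommGroup V] [Module ℝ V]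
    [TopologicalSpace V] {W : ℕ → Submodule ℝ V} {W₀ : Submodule ℝ V} (h : SubspaceTendsto W W₀) :
    ∀ᶠ k in atTop, Module.finrank ℝ (W k) = Module.finrank ℝ W₀ := by
  obtain ⟨m, b, b₀, ⟨h1, h2⟩, hk, -⟩ := h
  filter_upwards [hk] with k hk
  rw [← h2, ← hk.2, finrank_span_eq_card h1, finrank_span_eq_card hk.1]

theorem SubspaceTendsto.exists_tendsto {V : Type*} [AddCommGroup V] [Module ℝ V]
    [TopologicalSpace V] [IsTopologicalAddGroup V] [ContinuousSMul ℝ V] {W : ℕ → Submodule ℝ V}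
    {W₀ : Submodule ℝ V} (h : SubspaceTendsto W W₀) {x : V} (hx : x ∈ W₀) :
    ∃ xs : ℕ → V, Tendsto xs atTop (𝓝 x) ∧ ∀ᶠ k in atTop, xs k ∈ W k := by
  obtain ⟨m, b, b₀, ⟨-, h2⟩, hk, hlim⟩ := h
  rw [← h2, Submodule.mem_span_range_iff_exists_fun] at hx
  obtain ⟨a, rfl⟩ := hx
  refine ⟨fun k => ∑ i, a i • b k i, tendsto_finsetSum _ fun i _ => (hlim i).const_smul _, ?_⟩
  filter_upwards [hk] with k hk
  rw [← hk.2]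
  exact Submodule.sum_mem _ fun i _ => Submodule.smul_mem _ _ (Submodule.subset_span ⟨i, rfl⟩)

/-! ### Limits of coadjoint orbits -/

section OrbitLimits

open RealInnerProductSpace

variable {𝔤 : Type*} [LieRing 𝔤] [LieAlgebra ℝ 𝔤] [FiniteDimensional ℝ 𝔤]
  [TopologicalSpace 𝔤] [IsTopologicalAddGroup 𝔤] [ContinuousSMul ℝ 𝔤] [T2Space 𝔤] [IsTwoStep 𝔤]

/-- The radical in Euclidean coordinates. -/
def euclideanRadical (ℓ : Module.Dual ℝ 𝔤) :
    Submodule ℝ (EuclideanSpace ℝ (Fin (Module.finrank ℝ 𝔤))) :=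
  (radical ℓ).map (toEuclidean (E := 𝔤)).toLinearMap

theorem toEuclidean_mem {ℓ : Module.Dual ℝ 𝔤} {x : 𝔤} :
    toEuclidean x ∈ euclideanRadical ℓ ↔ x ∈ radical ℓ := by
  constructor
  · rintro ⟨y, hy, h⟩
    rwa [← (toEuclidean (E := 𝔤)).injective h]
  · exact fun h => ⟨x, h, rfl⟩

theorem symm_mem_radical {ℓ : Module.Dual ℝ 𝔤}
    {y : EuclideanSpace ℝ (Fin (Module.finrank ℝ 𝔤))} (hy : y ∈ euclideanRadical ℓ) :
    (toEuclidean (E := 𝔤)).symm y ∈ radical ℓ := by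
  rw [← toEuclidean_mem, ContinuousLinearEquiv.apply_symm_apply]
  exact hy

/-- The limits of orbits with converging radicals form an affine subspace. -/
theorem mem_orbitUnion_iff_of_isFrameLimit {O : ℕ → OrbitSpace 𝔤} {ℓ : Module.Dual ℝ 𝔤}
    {ℓs : ℕ → Module.Dual ℝ 𝔤} (hℓs : ∀ k, ℓs k ∈ (O k).orbit) (hlim : Tendsto ℓs atTop (𝓝 ℓ))
    {n : ℕ} {c : ℕ → Fin n → EuclideanSpace ℝ (Fin (Module.finrank ℝ 𝔤))}
    {c₀ : Fin n → EuclideanSpace ℝ (Fin (Module.finrank ℝ 𝔤))}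
    (hF : IsFrameLimit (fun k => euclideanRadical (ℓs k)) c c₀) {m : Module.Dual ℝ 𝔤} :
    m ∈ orbitUnion (limitSet O) ↔ m - ℓ ∈ (Submodule.span ℝ
      (Set.range fun i => (toEuclidean (E := 𝔤)).symm (c₀ i))).dualAnnihilator := by
  have hclim : ∀ i, Tendsto (fun k => (toEuclidean (E := 𝔤)).symm (c k i)) atTop
      (𝓝 ((toEuclidean (E := 𝔤)).symm (c₀ i))) := fun i =>
    ((toEuclidean (E := 𝔤)).symm.continuous.tendsto _).comp (hF.tendsto i)
  have happ : ∀ {f : ℕ → Module.Dual ℝ 𝔤} {f₀ : Module.Dual ℝ 𝔤} (_ : Tendsto f atTop (𝓝 f₀)) (i),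
      Tendsto (fun k => f k ((toEuclidean (E := 𝔤)).symm (c k i))) atTop
        (𝓝 (f₀ ((toEuclidean (E := 𝔤)).symm (c₀ i)))) := fun hf i =>
    (continuous_dual_apply.tendsto (_, _)).comp (hf.prodMk_nhds (hclim i))
  rw [mem_orbitUnion_limitSet]
  constructor
  · rintro ⟨ms, hms, hm⟩
    have hle : Submodule.span ℝ (Set.range fun i => (toEuclidean (E := 𝔤)).symm (c₀ i)) ≤
        LinearMap.ker (m - ℓ) := by
      rw [Submodule.span_le]
      rintro _ ⟨i, rfl⟩
      refine sub_eq_zero.2 (tendsto_nhds_unique (happ hm i) ((happ hlim i).congr fun k => ?_))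
      exact (eq_on_radical_of_mem (hℓs k) (hms k) (symm_mem_radical (hF.mem k i))).symm
    exact (Submodule.mem_dualAnnihilator _).2 fun x hx => hle hx
  · intro hq
    set q := m - ℓ
    let φ : ℕ → Fin n → Module.Dual ℝ 𝔤 := fun k i =>
      (innerₗ _ (c k i)) ∘ₗ (toEuclidean (E := 𝔤)).toLinearMap
    let ms : ℕ → Module.Dual ℝ 𝔤 := fun k =>
      ℓs k + (q - ∑ i, q ((toEuclidean (E := 𝔤)).symm (c k i)) • φ k i)
    refine ⟨ms, fun k => ?_, ?_⟩
    · have h1 := mem_orbit_iff_orbitOf.1 (hℓs k)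
      rw [← h1, mem_orbitOf_iff, Submodule.mem_dualAnnihilator]
      intro x hx
      have h2 := sum_inner_smul_of_mem_span (hF.orthonormal k)
        (x := toEuclidean x) (by rw [hF.span_eq]; exact toEuclidean_mem.2 hx)
      have h3 : x = ∑ i, ⟪c k i, toEuclidean x⟫ • (toEuclidean (E := 𝔤)).symm (c k i) := by
        apply (toEuclidean (E := 𝔤)).injective
        rw [map_sum]
        simp only [map_smul, ContinuousLinearEquiv.apply_symm_apply]
        exact h2.symm
      have h4 : q x = ∑ i, q ((toEuclidean (E := 𝔤)).symm (c k i)) * φ k i x := by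
        conv_lhs => rw [h3]
        rw [map_sum]
        refine Finset.sum_congr rfl fun i _ => ?_
        rw [map_smul, smul_eq_mul, mul_comm]
        rfl
      simp only [ms, add_sub_cancel_left, LinearMap.sub_apply, LinearMap.sum_apply,
        LinearMap.smul_apply, smul_eq_mul]
      rw [h4, sub_self]
    · rw [tendsto_dual_iff]
      intro x
      have h1 : ∀ i, Tendsto (fun k => q ((toEuclidean (E := 𝔤)).symm (c k i)) * φ k i x) atTop
          (𝓝 (0 * ⟪c₀ i, toEuclidean x⟫)) := fun i => by
        have h2 := happ (tendsto_const_nhds (x := q)) i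
        rw [(Submodule.mem_dualAnnihilator _).1 hq _ (Submodule.subset_span ⟨i, rfl⟩)] at h2
        exact h2.mul ((hF.tendsto i).inner tendsto_const_nhds)
      have h3 := (tendsto_dual_iff.1 hlim x).add
        (tendsto_const_nhds (x := q x) |>.sub (tendsto_finsetSum Finset.univ fun i _ => h1 i))
      have h4 : ℓ x + (q x - ∑ i, 0 * ⟪c₀ i, toEuclidean x⟫) = m x := by
        simp [q]
      rw [h4] at h3
      refine h3.congr fun k => ?_
      simp [ms]

/-- The radicals of a properly converging sequence of orbits converge, and the limit determines
the set of limits. -/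
theorem ProperlyConverging.exists_limit_radical {O : ℕ → OrbitSpace 𝔤} (hO : ProperlyConverging O)
    {ℓ : Module.Dual ℝ 𝔤} {ℓs : ℕ → Module.Dual ℝ 𝔤} (hℓs : ∀ k, ℓs k ∈ (O k).orbit)
    (hlim : Tendsto ℓs atTop (𝓝 ℓ)) :
    ∃ u : LieSubalgebra ℝ 𝔤, SubspaceTendsto (fun k => radical (ℓs k)) u.toSubmodule ∧
      (∀ x y : 𝔤, ⁅x, y⁆ ∈ u) ∧ u.toSubmodule ≤ radical ℓ ∧
      ∀ m, m ∈ orbitUnion (limitSet O) ↔ m - ℓ ∈ u.toSubmodule.dualAnnihilator := by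
  have key : ∀ θ : ℕ → ℕ, StrictMono θ → ∀ (n : ℕ)
      (c : ℕ → Fin n → EuclideanSpace ℝ (Fin (Module.finrank ℝ 𝔤)))
      (c₀ : Fin n → EuclideanSpace ℝ (Fin (Module.finrank ℝ 𝔤))),
      IsFrameLimit ((fun k => euclideanRadical (ℓs k)) ∘ θ) c c₀ → ∀ m : Module.Dual ℝ 𝔤,
      m ∈ orbitUnion (limitSet O) ↔ m - ℓ ∈ (Submodule.span ℝ
        (Set.range fun i => (toEuclidean (E := 𝔤)).symm (c₀ i))).dualAnnihilator := by
    intro θ hθ n c c₀ hF m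
    rw [← hO.2 θ hθ]
    exact mem_orbitUnion_iff_of_isFrameLimit (O := O ∘ θ) (ℓs := ℓs ∘ θ) (fun k => hℓs _)
      (hlim.comp hθ.tendsto_atTop) hF
  obtain ⟨θ, hθ, n, c, c₀, hF⟩ := exists_isFrameLimit fun k => euclideanRadical (ℓs k)
  set U : Submodule ℝ 𝔤 := Submodule.span ℝ
    (Set.range fun i => (toEuclidean (E := 𝔤)).symm (c₀ i)) with hU
  have hmap : ∀ {n' : ℕ} (c' : Fin n' → EuclideanSpace ℝ (Fin (Module.finrank ℝ 𝔤))),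
      (Submodule.span ℝ (Set.range fun i => (toEuclidean (E := 𝔤)).symm (c' i))).map
        (toEuclidean (E := 𝔤)).toLinearMap = Submodule.span ℝ (Set.range c') := by
    intro n' c'
    rw [← Submodule.span_image, ← Set.range_comp]
    congr 2
    funext i
    exact (toEuclidean (E := 𝔤)).apply_symm_apply _
  have hbr : ∀ x y : 𝔤, ⁅x, y⁆ ∈ U := by
    intro x y
    have h1 := hF.mem_span_of_forall_mem (x := toEuclidean ⁅x, y⁆)
      fun k => toEuclidean_mem.2 (lie_mem_radical _ x y)
    rw [← hmap c₀] at h1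
    obtain ⟨z, hz, hzx⟩ := h1
    rwa [← (toEuclidean (E := 𝔤)).injective hzx]
  have hten : SubspaceTendsto (fun k => radical (ℓs k)) U := by
    refine SubspaceTendsto.map_symm (toEuclidean (E := 𝔤)) ?_
    refine subspaceTendsto_of_forall_isFrameLimit fun θ' hθ' n' c' c₀' hF' => ?_
    rw [hU, hmap, ← hmap c₀', ← hmap c₀]
    congr 1
    rw [← Subspace.dualAnnihilator_inj]
    ext q
    have h1 := key θ hθ n c c₀ hF (ℓ + q)
    rw [key θ' hθ' n' c' c₀' hF' (ℓ + q), add_sub_cancel_left] at h1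
    exact h1
  refine ⟨{ U with lie_mem' := fun {x y} _ _ => hbr x y }, hten, hbr, ?_, key θ hθ n c c₀ hF⟩
  intro x hx y
  obtain ⟨xs, hxs, hmem⟩ := hten.exists_tendsto hx
  have hbc : Tendsto (fun k => ⁅xs k, y⁆) atTop (𝓝 ⁅x, y⁆) :=
    (continuous_bracket.tendsto (x, y)).comp (hxs.prodMk_nhds tendsto_const_nhds)
  refine tendsto_nhds_unique
    ((continuous_dual_apply.tendsto (ℓ, ⁅x, y⁆)).comp (hlim.prodMk_nhds hbc)) ?_
  refine tendsto_const_nhds.congr' ?_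
  filter_upwards [hmem] with k hk
  exact (hk y).symm

end OrbitLimits

end TwoStep

end

theorem mainTheorem6 {𝔤 : Type*} [LieRing 𝔤] [LieAlgebra ℝ 𝔤] [FiniteDimensional ℝ 𝔤]
    [TopologicalSpace 𝔤] [IsTopologicalAddGroup 𝔤] [ContinuousSMul ℝ 𝔤] [T2Space 𝔤] [IsTwoStep 𝔤]
    (O : ℕ → OrbitSpace 𝔤) (hO : ProperlyConverging O)
    (ℓ : Module.Dual ℝ 𝔤) (hℓ : orbitOf ℓ ∈ limitSet O) :
    ∃ (ℓs : ℕ → Module.Dual ℝ 𝔤) (u : LieSubalgebra ℝ 𝔤) (d : ℕ),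
      (∀ k, ℓs k ∈ (O k).orbit) ∧
      Tendsto ℓs atTop (𝓝 ℓ) ∧
      SubspaceTendsto (fun k => radical (ℓs k)) u.toSubmodule ∧
      (∀ᶠ k in atTop, orbitDim (O k) = d) ∧
      (∀ x y : 𝔤, ⁅x, y⁆ ∈ u) ∧
      u.toSubmodule ≤ radical ℓ ∧
      orbitUnion (limitSet O) =
        (fun q => ℓ + q) '' (u.toSubmodule.dualAnnihilator : Set (Module.Dual ℝ 𝔤)) ∧
      ((u.toSubmodule = radical ℓ ∧
          limitSet O = {orbitOf ℓ} ∧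
          (orbitOf ℓ).orbit =
            (fun q => ℓ + q) '' ((radical ℓ).dualAnnihilator : Set (Module.Dual ℝ 𝔤))) ∨
        (IsChar ℓ ∧
          orbitUnion (limitSet O) =
            (fun q => ℓ + q) '' (u.toSubmodule.dualAnnihilator : Set (Module.Dual ℝ 𝔤)) ∧
          ∀ m ∈ orbitUnion (limitSet O), IsChar m) ∨
        (0 < orbitDim (orbitOf ℓ) ∧
          orbitDim (orbitOf ℓ) < d ∧
          orbitUnion (limitSet O) =
            ⋃ q ∈ u.toSubmodule.dualAnnihilator, (fun m => q + m) '' (orbitOf ℓ).orbit ∧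
          ∀ π : ℕ → UnitaryDual (Grp 𝔤), (∀ k, IsKirillovOrbit (O k) (π k)) →
            ∀ (p : LieSubalgebra ℝ 𝔤) (hp : IsPolarization ℓ p) (c : Coords p),
              (fun γ : UnitaryDual (Grp 𝔤) => γ.1) '' limitSet π =
                {C : RepClass (Grp 𝔤) | ∃ (q : Module.Dual ℝ 𝔤) (hq : IsChar q),
                  q ∈ u.toSubmodule.dualAnnihilator ∧
                  C = ⟦(inducedRep hp c).twist (unitaryChar q hq)
                    (continuous_unitaryChar q hq)⟧})) := by
  obtain ⟨ℓs, hℓs, hlim⟩ := tendsto_orbit_iff.1 hℓ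
  obtain ⟨u, hten, hbr, hle, hmem⟩ := hO.exists_limit_radical hℓs hlim
  have hunion : orbitUnion (limitSet O) =
      (fun q => ℓ + q) '' (u.toSubmodule.dualAnnihilator : Set (Module.Dual ℝ 𝔤)) := by
    ext m
    rw [hmem]
    constructor
    · exact fun h => ⟨m - ℓ, h, by simp⟩
    · rintro ⟨q, hq, rfl⟩
      simpa using hq
  have hself : ℓ ∈ (orbitOf ℓ).orbit := mem_orbit_iff_orbitOf.2 rfl
  have hdimℓ := orbitDim_add_finrank_radical hself
  refine ⟨ℓs, u, Module.finrank ℝ 𝔤 - Module.finrank ℝ u.toSubmodule, hℓs, hlim, hten, ?_, hbr,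
    hle, hunion, ?_⟩
  · filter_upwards [hten.eventually_finrank_eq] with k hk
    have h1 := orbitDim_add_finrank_radical (hℓs k)
    omega
  by_cases hu : u.toSubmodule = radical ℓ
  · refine Or.inl ⟨hu, ?_, orbitOf_orbit_eq_image ℓ⟩
    refine Set.eq_singleton_iff_unique_mem.2 ⟨hℓ, fun O' hO' => ?_⟩
    obtain ⟨m, rfl⟩ : ∃ m, orbitOf m = O' := Quotient.exists_rep O'
    have h1 : m ∈ orbitUnion (limitSet O) :=
      Set.mem_biUnion hO' (mem_orbit_iff_orbitOf.2 rfl)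
    rw [hmem, hu, ← mem_orbitOf_iff] at h1
    exact mem_orbit_iff_orbitOf.1 h1
  by_cases hchar : IsChar ℓ
  · refine Or.inr (Or.inl ⟨hchar, hunion, fun m hm x y => ?_⟩)
    rw [hmem] at hm
    rw [lie_eq_of_sub_mem hbr hm, hchar]
  have hanti : (radical ℓ).dualAnnihilator ≤ u.toSubmodule.dualAnnihilator :=
    Submodule.dualAnnihilator_anti hle
  refine Or.inr (Or.inr ⟨?_, ?_, ?_, fun π hπ p hp c => ?_⟩)
  · rw [pos_iff_ne_zero]
    intro h0
    rw [h0, zero_add] at hdimℓ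
    refine hchar fun x y => ?_
    have h1 : x ∈ radical ℓ := by rw [Submodule.eq_top_of_finrank_eq hdimℓ]; trivial
    exact h1 y
  · have h1 := Submodule.finrank_lt_finrank_of_lt (lt_of_le_of_ne hle hu)
    omega
  · ext m
    rw [hmem, Set.mem_iUnion₂]
    constructor
    · exact fun h => ⟨m - ℓ, h, ℓ, hself, by simp⟩
    · rintro ⟨q, hq, m', hm', rfl⟩
      rw [mem_orbitOf_iff] at hm'
      rw [add_sub_assoc]
      exact Submodule.add_mem _ hq (hanti hm')
  · refine limitSet_unitaryDual hℓs hlim hbr hle (fun x hx => hten.exists_tendsto hx)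
      (fun q hq => ?_) π hπ hp c
    rw [← mem_orbitUnion_limitSet, hmem]
    simpa using hq
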